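/- **Setting.** Let $K\ge 2$ and $\mu\in\mathbb R^K$ with $\mu_1>\mu_i$ for all $i\ge 2$; put $\Delta_i=\mu_1-\mu_i$, $\Delta_{\max}=\max_{i\ge2}\Delta_i$, $\Delta_{\min}=\min_{i\ge2}\Delta_i$. The successive rewards of arm $i$ are i.i.d. $\mathcal N(\mu_i,1)$, independently over the arms. Write $I(t)$ for the arm pulled in round $t$, and $N_i(t)$, $\hat\mu_i(t)$ for the number of pulls and the empirical mean of arm $i$ after round $t$. The ReMax algorithm with $M=2$ and the improper uniform prior pulls each arm once in rounds $1,\dots,K$; in every round $t>K$ it draws $I(t)$, with fresh randomness, from a probability vector $\pi_t$ that maximizes $$\pi\mapsto \mathbb E_{\theta}\,\mathbb E_{A_1,A_2\sim\pi\text{ i.i.d.}}\bigl[\max(\theta_{A_1},\theta_{A_2})\bigr]$$ over the probability simplex, where $\theta_1,\dots,\theta_K$ are independent with $\theta_i\sim\mathcal N\bigl(\hat\mu_i(t-1),1/N_i(t-1)\bigr)$. The regret is $\mathrm{Reg}(T)=\sum_{t=1}^T(\mu_1-\mu_{I(t)})$, and $D(p\,\|\,q)$ is the Kullback–Leibler divergence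 of $\mathcal N(p,1)$ from $\mathcal N(q,1)$. **Theorem.** There is an integer $p\ge0$ such that for every $B>0$ there is a constant $C>0$, depending only on $B$, with the following property. For all $K\ge2$, all $\mu$ as above and all $T\ge1$: 1. for every $\varepsilon\in(0,\Delta_{\min}/5]$ with $\varepsilon\le B$, $$\mathbb E[\mathrm{Reg}(T)]\le\sum_{i=2}^K C\,\frac{\Delta_i\log T}{D(\mu_i+\varepsilon\,\|\,\mu_1-\varepsilon/2)}+\Delta_{\max}\,C\,\Bigl(\log\bigl(2+\tfrac{KT}{\varepsilon}\bigr)\Bigr)^{p}\,\frac{K^{1/3}T^{2/3}}{\varepsilon^3};$$ 2. if $\Delta_{\min}\le B$, $$\mathbb E[\mathrm{Reg}(T)]\le\sum_{i=2}^K C\,\frac{\log T}{\Delta_i}+\Delta_{\max}\,C\,\Bigl(\log\bigl(2+\tfrac{KT}{\Delta_{\min}}\bigr)\Bigr)^{p}\,\frac{K^{1/3}T^{2/3}}{\Delta_{\min}^3}.$$ Moreover, for every fixed $K\ge2$ and $\mu$ as above, $\mathbb E[\mathrm{Reg}(T)]=o(T)$ as $T\to\infty$. -/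

import Mathlib

open MeasureTheory ProbabilityTheory
open scoped NNReal

namespace ReMax

noncomputable section

/-! ### The objective and its maximizers -/

/-- The ReMax objective `J^(M)(π; Π) = E_{θ ∼ Π} E_{A_1, …, A_M ∼ π iid} [max_m θ_{A_m}]`. The inner
expectation is the finite sum over all index tuples `A`; an arm that occurs several times in `A`
contributes the same sampled value `θ i` each time. -/
def objective {K : ℕ} (M : ℕ) (Pi : Measure (Fin K → ℝ)) (π : Fin K → ℝ) : ℝ :=
  ∫ θ, ∑ A : Fin M → Fin K, (∏ m, π (A m)) * (⨆ m, θ (A m)) ∂Pi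

/-- `π` is a probability vector on the arms that maximizes the ReMax objective. -/
def IsOptimalPolicy {K : ℕ} (M : ℕ) (Pi : Measure (Fin K → ℝ)) (π : Fin K → ℝ) : Prop :=
  π ∈ stdSimplex ℝ (Fin K) ∧ IsMaxOn (objective M Pi) (stdSimplex ℝ (Fin K)) π

/-- The posterior of the arm values for unit-variance Gaussian rewards and the improper uniform
prior: independent coordinates with laws `N(m i, 1 / n i)`, where `m i` is the empirical mean of
arm `i` and `n i` its number of pulls. -/
def posterior {K : ℕ} (m : Fin K → ℝ) (n : Fin K → ℕ) : Measure (Fin K → ℝ) :=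
  Measure.pi fun i => gaussianReal (m i) ((n i : ℝ≥0)⁻¹)

/-! ### The interaction. Rounds are numbered `0, 1, 2, …`; `I t` is the arm pulled in round `t`, and
`X i n` is the reward that the pull number `n` (counted from `0`) of arm `i` produces. -/

variable {Ω : Type*} {K : ℕ}

/-- Number of pulls of arm `i` in the first `t` rounds. -/
def pulls (I : ℕ → Ω → Fin K) (i : Fin K) (t : ℕ) (ω : Ω) : ℕ :=
  ((Finset.range t).filter fun s => I s ω = i).card

/-- The reward observed in round `t`. -/
def reward (X : Fin K → ℕ → Ω → ℝ) (I : ℕ → Ω → Fin K) (t : ℕ) (ω : Ω) : ℝ :=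
  X (I t ω) (pulls I (I t ω) t ω) ω

/-- Empirical mean of the rewards observed from arm `i` in the first `t` rounds. -/
def empMean (X : Fin K → ℕ → Ω → ℝ) (I : ℕ → Ω → Fin K) (i : Fin K) (t : ℕ) (ω : Ω) : ℝ :=
  (∑ s ∈ (Finset.range t).filter (fun s => I s ω = i), reward X I s ω) / (pulls I i t ω : ℝ)

/-- The information generated by all potential rewards and by the arms pulled before round `t`. It
determines everything observed before round `t`. -/
abbrev past (X : Fin K → ℕ → Ω → ℝ) (I : ℕ → Ω → Fin K) (t : ℕ) : MeasurableSpace Ω :=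
  (⨆ i, ⨆ n, MeasurableSpace.comap (X i n) inferInstance) ⊔
    ⨆ s ∈ Finset.range t, MeasurableSpace.comap (I s) inferInstance

/-- `(X, I)` is a run of the ReMax algorithm (with `M` draws in the objective) on the `K`-armed
bandit with unit-variance Gaussian rewards of means `μ`. -/
structure IsRun [MeasurableSpace Ω] (P : Measure Ω) (M : ℕ) (μ : Fin K → ℝ)
    (X : Fin K → ℕ → Ω → ℝ) (I : ℕ → Ω → Fin K) : Prop where
  measurable_reward : ∀ i n, Measurable (X i n)
  measurable_arm : ∀ t, Measurable (I t)
  /-- rewards of arm `i` have law `N(μ i, 1)` -/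
  reward_law : ∀ i n, P.map (X i n) = gaussianReal (μ i) 1
  /-- all rewards are independent -/
  reward_indep : iIndepFun (fun q : Fin K × ℕ => X q.1 q.2) P
  /-- in the first `K` rounds each arm is pulled once -/
  initial : ∀ t (ht : t < K), ∀ᵐ ω ∂P, I t ω = ⟨t, ht⟩
  /-- afterwards the arm is drawn, with fresh randomness, from a maximizer of the objective under
  the current posterior -/
  arm_law : ∀ t, K ≤ t → ∀ᵐ ω ∂P,
    IsOptimalPolicy M (posterior (fun i => empMean X I i t ω) (fun i => pulls I i t ω))
      (fun i => condExp (past X I t) P ((I t ⁻¹' {i}).indicator fun _ => (1 : ℝ)) ω)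

/-! ### Regret and gaps. Arm `0` is the optimal arm. -/

/-- The regret of the first `T` rounds. -/
def regret [NeZero K] (μ : Fin K → ℝ) (I : ℕ → Ω → Fin K) (T : ℕ) (ω : Ω) : ℝ :=
  ∑ t ∈ Finset.range T, (μ 0 - μ (I t ω))

/-- The suboptimality gap of arm `i`. -/
def gap [NeZero K] (μ : Fin K → ℝ) (i : Fin K) : ℝ := μ 0 - μ i

/-- The largest gap of an arm other than arm `0`. -/
def gapMax [NeZero K] (μ : Fin K → ℝ) : ℝ := ⨆ i : {i : Fin K // i ≠ 0}, gap μ i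

/-- The smallest gap of an arm other than arm `0`. -/
def gapMin [NeZero K] (μ : Fin K → ℝ) : ℝ := ⨅ i : {i : Fin K // i ≠ 0}, gap μ i

/-- Kullback–Leibler divergence of the unit-variance Gaussians with means `p` and `q`. -/
def D (p q : ℝ) : ℝ := (InformationTheory.klDiv (gaussianReal p 1) (gaussianReal q 1)).toReal

end

end ReMax

/-! After the initial rounds, a pull of a suboptimal arm `i` has one of four causes: arm `i` is
overestimated; it has at most a constant times `log T / Δ_i ^ 2` pulls; it is explored and both its
mean and that of arm `0` are estimated well; or arm `0` is underestimated. Successive pulls of an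
arm meet distinct sample sizes, so the first two causes are charged to sample sizes, where Gaussian
tails are summable.

For the third cause, the objective with two draws is a quadratic form in `π` with matrix `pairMax`,
so every arm in the support of a maximizer has maximal marginal value
(`IsOptimalPolicy.marginal_le`). Comparing arms `i` and `0` bounds `π i` by the surplus of arm `i`
over a level between the means plus `π 0` times the shortfall of arm `0`
(`IsOptimalPolicy.mul_sub_le`). The surplus is at most `1 / T`, and the shortfall is charged to
pulls of arm `0`.

The fourth cause produces the `K^(1/3) T^(2/3)` term. If `π` gives enough mass to arm `0` or to
overestimated arms, the round is again charged to their pulls. Otherwise mass at least `1/4` lies on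
arms with posterior mean at most `μ 0 - 4 ε`. If arm `0` has surplus at least `4 η` over that level,
then every arm in the support has marginal value at least `η` above the mean under `π`.
Well-explored arms alone cannot provide this, so mass of order `η / log (1/η)` lies on arms with at
most `16 / η ^ 2` pulls (`le_mul_sum_few_pulls`). Only `16 K / η ^ 2` such pulls exist, so an event
`E` on the first `k` rewards of arm `0` costs at most about `K η⁻³ P(E)` rounds
(`IsRun.sum_stuck_le`), and trivially at most `T P(E)`.

Interpolating the two bounds gives `K^(1/3) T^(2/3) P(E) / η` up to logarithms. On the slice where
arm `0` is underestimated at level `l`, `1/η` is of order `√k (l+1) e^l` while `P(E) ≤ e^(-l) e^(-k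
ε²/8)`: the factor `e^l` cancels, the sum over `k` gives `ε⁻³`, and the roughly `log T` levels cost
one more logarithm. -/

namespace ReMax

/-! ### Gaussian estimates -/

/-- The expected amount by which a Gaussian variable exceeds a level. -/
noncomputable def surplus (m : ℝ) (v : ℝ≥0) (u : ℝ) : ℝ :=
  ∫ x, max (x - u) 0 ∂gaussianReal m v

lemma integrable_id_gaussian (m : ℝ) (v : ℝ≥0) : Integrable (fun x : ℝ => x) (gaussianReal m v) :=
  (memLp_id_gaussianReal 1).integrable le_rfl

lemma integrable_max_sub (m : ℝ) (v : ℝ≥0) (u : ℝ) :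
    Integrable (fun x : ℝ => max (x - u) 0) (gaussianReal m v) :=
  ((integrable_id_gaussian m v).sub (integrable_const u)).sup (integrable_const 0)

lemma surplus_anti (m : ℝ) (v : ℝ≥0) {u u' : ℝ} (h : u ≤ u') : surplus m v u' ≤ surplus m v u :=
  integral_mono (integrable_max_sub m v u') (integrable_max_sub m v u)
    fun x => max_le_max (by linarith) le_rfl

/-- Reflection turns shortfalls into surpluses, so one tail bound serves both. -/
lemma integral_max_rev (m : ℝ) (v : ℝ≥0) (u : ℝ) :
    ∫ x, max (u - x) 0 ∂gaussianReal m v = surplus (-m) v (-u) := by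
  rw [surplus, ← gaussianReal_map_neg, integral_map (by fun_prop) (by fun_prop)]
  refine integral_congr_ae (ae_of_all _ fun x => ?_)
  simp only
  ring_nf

lemma integrable_sq_gaussian (m : ℝ) (v : ℝ≥0) :
    Integrable (fun x : ℝ => x ^ 2) (gaussianReal m v) :=
  (memLp_id_gaussianReal 2).integrable_sq

lemma integral_sq_gaussian (v : ℝ≥0) : ∫ x, x ^ 2 ∂gaussianReal 0 v = v := by
  have h := variance_id_gaussianReal (μ := 0) (v := v)
  rw [variance_eq_integral (by fun_prop)] at h
  simpa using h

/-- Expanding `(x - √v) ^ 2 ≥ 0` bounds `x` by a quadratic whose mean is `√v`. -/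
lemma surplus_zero_le {v : ℝ≥0} (hv : v ≠ 0) : surplus 0 v 0 ≤ √v := by
  have hs : 0 < √(v : ℝ) := Real.sqrt_pos.2 (by positivity)
  have hs2 : √(v : ℝ) ^ 2 = v := Real.sq_sqrt v.2
  have h1 : Integrable (fun x : ℝ => (x ^ 2 * (√v)⁻¹ + √v) / 2) (gaussianReal 0 v) :=
    (((integrable_sq_gaussian 0 v).mul_const _).add (integrable_const _)).div_const 2
  calc surplus 0 v 0 ≤ ∫ x, (x ^ 2 * (√v)⁻¹ + √v) / 2 ∂gaussianReal 0 v := by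
        refine integral_mono (integrable_max_sub 0 v 0) h1 fun x => ?_
        simp only [sub_zero]
        have : (x ^ 2 * (√v)⁻¹ + √v) / 2 - x = (x - √v) ^ 2 * (√v)⁻¹ / 2 := by
          field_simp; ring
        refine max_le ?_ (by positivity)
        have h3 : 0 ≤ (x - √v) ^ 2 * (√(v : ℝ))⁻¹ / 2 := by positivity
        linarith
    _ = √v := by
        rw [integral_div, integral_add ((integrable_sq_gaussian 0 v).mul_const _)
          (integrable_const _), integral_mul_const, integral_sq_gaussian]
        simp only [integral_const, probReal_univ, one_smul]
        field_simp
        rw [hs2]; ring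

lemma surplus_eq_integral (m : ℝ) {v : ℝ≥0} (hv : v ≠ 0) (u : ℝ) :
    surplus m v u = ∫ w, gaussianPDFReal m v (w + u) * max w 0 := by
  rw [surplus, integral_gaussianReal_eq_integral_smul hv,
    ← integral_add_right_eq_self (μ := volume) _ u]
  simp

lemma integrable_pdf_mul (m : ℝ) {v : ℝ≥0} (hv : v ≠ 0) (u : ℝ) :
    Integrable (fun w => gaussianPDFReal m v (w + u) * max w 0) := by
  have h := integrable_max_sub m v u
  rw [gaussianReal_of_var_ne_zero _ hv, gaussianPDF_def,
    integrable_withDensity_iff_integrable_smul' (by fun_prop)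
      (ae_of_all _ fun _ => ENNReal.ofReal_lt_top)] at h
  have h2 := h.comp_add_right u
  refine h2.congr (ae_of_all _ fun x => ?_)
  simp [ENNReal.toReal_ofReal (gaussianPDFReal_nonneg m v _)]

/-- Upper bound for the surplus over a level above the mean. -/
lemma surplus_le {m u : ℝ} {v : ℝ≥0} (hv : v ≠ 0) (hu : m ≤ u) :
    surplus m v u ≤ √v * Real.exp (-((u - m) ^ 2 / (2 * v))) := by
  have hv' : (0 : ℝ) < v := by positivity
  have h0 : surplus 0 v 0 = ∫ w, gaussianPDFReal 0 v w * max w 0 := by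
    simpa using surplus_eq_integral 0 hv 0
  have hi : Integrable (fun w => gaussianPDFReal 0 v w * max w 0) := by
    simpa using integrable_pdf_mul 0 hv 0
  calc surplus m v u = ∫ w, gaussianPDFReal m v (w + u) * max w 0 := surplus_eq_integral m hv u
    -- For `w ≥ 0` and `u ≥ m` the cross term in `(w + (u - m)) ^ 2` is nonnegative, so the
    -- exponential splits off.
    _ ≤ ∫ w, (gaussianPDFReal 0 v w * max w 0) * Real.exp (-((u - m) ^ 2 / (2 * v))) := by
        refine integral_mono (integrable_pdf_mul m hv u) (hi.mul_const _) fun w => ?_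
        simp only
        rcases le_or_gt w 0 with hw | hw
        · simp [max_eq_right hw]
        · rw [max_eq_left hw.le, mul_right_comm]
          refine mul_le_mul_of_nonneg_right ?_ hw.le
          rw [gaussianPDFReal, gaussianPDFReal, mul_assoc (√_)⁻¹, ← Real.exp_add]
          refine mul_le_mul_of_nonneg_left (Real.exp_le_exp.2 ?_) (by positivity)
          rw [← neg_div', ← neg_div', ← neg_add, neg_le_neg_iff, ← add_div]
          refine div_le_div_of_nonneg_right ?_ (by positivity)
          nlinarith [mul_nonneg hw.le (sub_nonneg.2 hu)]
    _ = surplus 0 v 0 * Real.exp (-((u - m) ^ 2 / (2 * v))) := by rw [integral_mul_const, h0]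
    _ ≤ _ := mul_le_mul_of_nonneg_right (surplus_zero_le hv) (Real.exp_pos _).le

lemma sqrt_two_pi_le : √(2 * Real.pi) ≤ Real.exp 1 := by
  have h1 := Real.pi_lt_d2
  have h2 := Real.exp_one_gt_d9
  refine Real.sqrt_le_iff.2 ⟨by positivity, ?_⟩
  nlinarith

/-- Lower bound for the surplus over a level that is `y` standard deviations above the mean. -/
lemma le_surplus {m u y : ℝ} {v : ℝ≥0} (hv : v ≠ 0) (hy : 0 ≤ y) (hu : u ≤ m + √v * y) :
    √v * (Real.exp (-5) * Real.exp (-(y ^ 2 / 2)) / (1 + y) ^ 2) ≤ surplus m v u := by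
  refine le_trans ?_ (surplus_anti m v hu)
  have hv' : (0 : ℝ) < v := by positivity
  have hs : 0 < √(v : ℝ) := Real.sqrt_pos.2 hv'
  have hs2 : √(v : ℝ) ^ 2 = v := Real.sq_sqrt v.2
  have hy1 : 0 < 1 + y := by linarith
  -- The surplus is bounded below on the window `[a, 2a]` above the level. Since `a ≤ √v` and `a * y
  -- ≤ √v`, the exponent exceeds `y ^ 2 / 2` there by at most `4`; the estimate `√(2π) ≤ e` accounts
  -- for the fifth unit in `exp (-5)`.
  set a : ℝ := √v / (1 + y) with ha
  have ha0 : 0 < a := by positivity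
  set q : ℝ := Real.exp (-5) * Real.exp (-(y ^ 2 / 2)) / √v with hq
  have hpdf : ∀ w ∈ Set.Icc a (2 * a), q ≤ gaussianPDFReal m v (w + (m + √v * y)) := by
    intro w hw
    have hw0 : 0 ≤ w := ha0.le.trans hw.1
    rw [gaussianPDFReal, hq]
    have e1 : w + (m + √v * y) - m = w + √v * y := by ring
    have e2 : √(2 * Real.pi * v) = √(2 * Real.pi) * √v := Real.sqrt_mul (by positivity) _
    rw [e1, e2]
    have e3 : (w + √v * y) ^ 2 / (2 * v) ≤ y ^ 2 / 2 + 4 := by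
      rw [div_le_iff₀ (by positivity)]
      have e4 : w ≤ 2 * a := hw.2
      have e5 : a * y ≤ √v := by
        rw [ha, div_mul_eq_mul_div, div_le_iff₀ hy1]; nlinarith
      have e6 : a ≤ √v := by
        rw [ha, div_le_iff₀ hy1]; nlinarith
      have e7 : (w + √v * y) ^ 2 ≤ (2 * a + √v * y) ^ 2 := by gcongr
      have e8 : (2 * a + √v * y) ^ 2 ≤ 8 * √v ^ 2 + √v ^ 2 * y ^ 2 := by
        nlinarith [mul_le_mul_of_nonneg_left e5 hs.le, mul_le_mul e6 e6 ha0.le hs.le]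
      rw [hs2] at e8
      nlinarith
    have e9 : (√(2 * Real.pi) * √(v : ℝ))⁻¹ ≥ (Real.exp 1 * √v)⁻¹ := by
      have := sqrt_two_pi_le
      have : 0 < √(2 * Real.pi) := by positivity
      gcongr
    calc Real.exp (-5) * Real.exp (-(y ^ 2 / 2)) / √v
        = (Real.exp 1 * √v)⁻¹ * Real.exp (-(y ^ 2 / 2 + 4)) := by
          rw [mul_inv, ← Real.exp_neg, mul_right_comm, ← Real.exp_add, ← Real.exp_add,
            div_eq_mul_inv]
          ring_nf
      _ ≤ (√(2 * Real.pi) * √v)⁻¹ * Real.exp (-(w + √v * y) ^ 2 / (2 * v)) := by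
          rw [neg_div]
          gcongr
  have hq0 : 0 ≤ q := by positivity
  calc √v * (Real.exp (-5) * Real.exp (-(y ^ 2 / 2)) / (1 + y) ^ 2)
      = ∫ w in Set.Icc a (2 * a), q * a := by
        rw [setIntegral_const]
        simp only [Real.volume_real_Icc, smul_eq_mul]
        rw [max_eq_left (by linarith), hq, ha]
        field_simp
        ring
    _ ≤ ∫ w in Set.Icc a (2 * a), gaussianPDFReal m v (w + (m + √v * y)) * max w 0 := by
        refine setIntegral_mono_on (integrableOn_const (by simp))
          (integrable_pdf_mul m hv _).integrableOn measurableSet_Icc fun w hw => ?_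
        exact mul_le_mul (hpdf w hw) (hw.1.trans (le_max_left _ _)) ha0.le
          (gaussianPDFReal_nonneg _ _ _)
    _ ≤ ∫ w, gaussianPDFReal m v (w + (m + √v * y)) * max w 0 :=
        setIntegral_le_integral (integrable_pdf_mul m hv _) (ae_of_all _ fun w =>
          mul_nonneg (gaussianPDFReal_nonneg _ _ _) (le_max_right _ _))
    _ = surplus m v (m + √v * y) := (surplus_eq_integral m hv _).symm

/-! ### The divergence of unit-variance Gaussians -/

/-- The log-likelihood ratio is affine, so its mean under the first law is `(p - q) * p - (p ^ 2 - q
^ 2) / 2`. -/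
lemma D_eq (p q : ℝ) : D p q = (p - q) ^ 2 / 2 := by
  have hwd : gaussianReal p 1 = (gaussianReal q 1).withDensity
      fun x => ENNReal.ofReal (Real.exp ((p - q) * x - (p ^ 2 - q ^ 2) / 2)) := by
    rw [gaussianReal_of_var_ne_zero _ one_ne_zero, gaussianReal_of_var_ne_zero _ one_ne_zero,
      ← withDensity_mul _ (by fun_prop) (by fun_prop)]
    congr 1
    ext x
    simp only [gaussianPDF, Pi.mul_apply]
    rw [← ENNReal.ofReal_mul (gaussianPDFReal_nonneg _ _ _), gaussianPDFReal, gaussianPDFReal,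
      mul_assoc (√_)⁻¹, ← Real.exp_add]
    congr 3
    push_cast
    ring
  have hac : gaussianReal p 1 ≪ gaussianReal q 1 := by
    rw [hwd]; exact withDensity_absolutelyContinuous _ _
  rw [D, InformationTheory.toReal_klDiv_of_measure_eq hac (by simp)]
  have hr : (gaussianReal p 1).rnDeriv (gaussianReal q 1) =ᵐ[gaussianReal p 1]
      fun x => ENNReal.ofReal (Real.exp ((p - q) * x - (p ^ 2 - q ^ 2) / 2)) := by
    refine hac.ae_le ?_
    rw [hwd]
    exact Measure.rnDeriv_withDensity _ (by fun_prop)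
  have hl : llr (gaussianReal p 1) (gaussianReal q 1) =ᵐ[gaussianReal p 1]
      fun x => (p - q) * x - (p ^ 2 - q ^ 2) / 2 := by
    filter_upwards [hr] with x hx
    rw [llr, hx, ENNReal.toReal_ofReal (Real.exp_pos _).le, Real.log_exp]
  rw [integral_congr_ae hl, integral_sub ((integrable_id_gaussian p 1).const_mul _)
    (integrable_const _), integral_const_mul, integral_id_gaussianReal]
  simp
  ring

lemma integral_add_add {α : Type*} [MeasurableSpace α] {ν : Measure α} {f g h : α → ℝ}
    (hf : Integrable f ν) (hg : Integrable g ν) (hh : Integrable h ν) :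
    ∫ x, (f x + g x + h x) ∂ν = ∫ x, f x ∂ν + ∫ x, g x ∂ν + ∫ x, h x ∂ν := by
  rw [integral_add (f := fun x => f x + g x) (hf.add hg) hh, integral_add hf hg]

/-! ### Pairs of posterior samples -/

section Posterior

variable {K : ℕ} (m : Fin K → ℝ) (n : Fin K → ℕ)

instance : IsProbabilityMeasure (posterior m n) := by
  unfold posterior; infer_instance

lemma map_eval_posterior (i : Fin K) :
    (posterior m n).map (fun θ => θ i) = gaussianReal (m i) ((n i : ℝ≥0)⁻¹) :=
  (measurePreserving_eval _ i).map_eq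

lemma integral_eval_posterior (i : Fin K) {f : ℝ → ℝ} (hf : Measurable f) :
    ∫ θ, f (θ i) ∂posterior m n = ∫ x, f x ∂gaussianReal (m i) ((n i : ℝ≥0)⁻¹) := by
  rw [← map_eval_posterior m n i, integral_map (measurable_pi_apply i).aemeasurable hf.aestronglyMeasurable]

lemma integrable_comp_eval (i : Fin K) {f : ℝ → ℝ}
    (hf : Integrable f (gaussianReal (m i) ((n i : ℝ≥0)⁻¹))) :
    Integrable (fun θ => f (θ i)) (posterior m n) := by
  rw [← map_eval_posterior m n i] at hf
  exact hf.comp_measurable (by fun_prop)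

lemma integrable_eval (i : Fin K) : Integrable (fun θ => θ i) (posterior m n) :=
  integrable_comp_eval m n i (integrable_id_gaussian _ _)

lemma integral_eval (i : Fin K) : ∫ θ, θ i ∂posterior m n = m i := by
  rw [integral_eval_posterior m n i (f := fun x => x) measurable_id, integral_id_gaussianReal]

/-- The surplus of arm `i` excess the level `u`. -/
noncomputable def excess (i : Fin K) (u : ℝ) : ℝ := ∫ θ, max (θ i - u) 0 ∂posterior m n

/-- The shortfall of arm `i` below the level `u`. -/
noncomputable def deficit (i : Fin K) (u : ℝ) : ℝ := ∫ θ, max (u - θ i) 0 ∂posterior m n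

/-- The expected maximum of the samples of the arms `i` and `j`. -/
noncomputable def pairMax (i j : Fin K) : ℝ := ∫ θ, max (θ i) (θ j) ∂posterior m n

lemma excess_eq (i : Fin K) (u : ℝ) : excess m n i u = surplus (m i) ((n i : ℝ≥0)⁻¹) u :=
  integral_eval_posterior m n i (f := fun x => max (x - u) 0) (by fun_prop)

lemma deficit_eq (i : Fin K) (u : ℝ) : deficit m n i u = surplus (-m i) ((n i : ℝ≥0)⁻¹) (-u) := by
  rw [← integral_max_rev]
  exact integral_eval_posterior m n i (f := fun x => max (u - x) 0) (by fun_prop)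

lemma excess_nonneg (i : Fin K) (u : ℝ) : 0 ≤ excess m n i u := integral_nonneg fun _ => le_max_right _ _

lemma deficit_nonneg (i : Fin K) (u : ℝ) : 0 ≤ deficit m n i u :=
  integral_nonneg fun _ => le_max_right _ _

lemma integrable_excess (i : Fin K) (u : ℝ) :
    Integrable (fun θ => max (θ i - u) 0) (posterior m n) :=
  ((integrable_eval m n i).sub (integrable_const u)).sup (integrable_const 0)

lemma integrable_deficit (i : Fin K) (u : ℝ) :
    Integrable (fun θ => max (u - θ i) 0) (posterior m n) :=
  ((integrable_const u).sub (integrable_eval m n i)).sup (integrable_const 0)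

lemma integrable_max (i j : Fin K) : Integrable (fun θ => max (θ i) (θ j)) (posterior m n) :=
  (integrable_eval m n i).sup (integrable_eval m n j)

lemma pairMax_self (i : Fin K) : pairMax m n i i = m i := by
  simp [pairMax, integral_eval]

lemma pairMax_comm (i j : Fin K) : pairMax m n i j = pairMax m n j i := by
  simp [pairMax, max_comm]

lemma le_pairMax_right (i j : Fin K) : m j ≤ pairMax m n i j := by
  rw [← integral_eval m n j]
  exact integral_mono (integrable_eval m n j) (integrable_max m n i j) fun θ => le_max_right _ _

/-- Useful with `u` between the two means: both error terms are then tails. -/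
lemma pairMax_le (i j : Fin K) (u : ℝ) :
    pairMax m n i j ≤ m j + excess m n i u + deficit m n j u := by
  rw [← integral_eval m n j, excess, deficit, ← integral_add_add (integrable_eval m n j)
    (integrable_excess m n i u) (integrable_deficit m n j u)]
  refine integral_mono (integrable_max m n i j) (((integrable_eval m n j).add
    (integrable_excess m n i u)).add (integrable_deficit m n j u)) fun θ => ?_
  have h1 := le_max_left (θ i - u) 0
  have h2 := le_max_right (θ i - u) 0
  have h3 := le_max_left (u - θ j) 0
  have h4 := le_max_right (u - θ j) 0
  exact max_le (by simp only; linarith) (by simp only; linarith)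

/-- Comparison with the maximum of a level and a sample. -/
lemma pairMax_le_level (i j : Fin K) (u : ℝ) :
    pairMax m n i j ≤ (u + excess m n j u) + excess m n i u := by
  have h : u = ∫ _, u ∂posterior m n := by simp
  have hc : Integrable (fun _ : Fin K → ℝ => u) (posterior m n) := integrable_const u
  have hj := integrable_excess m n j u
  have hi := integrable_excess m n i u
  calc pairMax m n i j ≤ ∫ θ, ((u + max (θ j - u) 0) + max (θ i - u) 0) ∂posterior m n := by
        refine integral_mono (integrable_max m n i j) ((hc.add hj).add hi) fun θ => ?_
        have h1 := le_max_left (θ i - u) 0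
        have h2 := le_max_right (θ i - u) 0
        have h3 := le_max_left (θ j - u) 0
        have h4 := le_max_right (θ j - u) 0
        exact max_le (by simp only; linarith) (by simp only; linarith)
    _ = _ := by
        rw [integral_add_add hc hj hi, ← h]; rfl

/-- Averaging out an independent sample decreases the expected maximum. -/
lemma add_excess_le_pairMax {i j : Fin K} (hij : i ≠ j) {u : ℝ} (hu : m j ≤ u) :
    m j + excess m n i u ≤ pairMax m n i j := by
  have hind : IndepFun (fun θ : Fin K → ℝ => θ i) (fun θ => θ j) (posterior m n) := by
    have := iIndepFun_pi (μ := fun i => gaussianReal (m i) ((n i : ℝ≥0)⁻¹))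
      (X := fun _ x => x) (fun i => aemeasurable_id)
    exact this.indepFun hij
  -- `ind (θ i)` is a subgradient of `y ↦ max (θ i) y` at `m j`. By independence the linear term it
  -- multiplies has mean zero.
  set ind : ℝ → ℝ := fun x => if x < m j then 1 else 0 with hindd
  have hm : Measurable ind := Measurable.ite measurableSet_Iio measurable_const measurable_const
  have h1 : ∫ θ, ind (θ i) * (θ j - m j) ∂posterior m n = 0 := by
    have h2 := IndepFun.integral_fun_mul_eq_mul_integral
      (hind.comp (φ := ind) (ψ := fun x => x - m j) hm (by fun_prop))
      (by exact (hm.comp (measurable_pi_apply i)).aestronglyMeasurable)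
      (by exact ((measurable_pi_apply j).sub_const _).aestronglyMeasurable)
    have h3 : ∫ θ, (θ j - m j) ∂posterior m n = 0 := by
      rw [integral_sub (integrable_eval m n j) (integrable_const _), integral_eval]; simp
    simp only [Function.comp_def] at h2
    rw [h2, h3, mul_zero]
  have hj : Integrable (fun θ : Fin K → ℝ => θ j - m j) (posterior m n) :=
    (integrable_eval m n j).sub (integrable_const _)
  have hi1 : Integrable (fun θ => ind (θ i) * (θ j - m j)) (posterior m n) := by
    refine hj.bdd_mul (c := 1) (hm.comp (measurable_pi_apply i)).aestronglyMeasurable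
      (ae_of_all _ fun θ => ?_)
    simp only [hindd]
    split_ifs <;> simp
  have hc : Integrable (fun _ : Fin K → ℝ => m j) (posterior m n) := integrable_const _
  have hi := integrable_excess m n i (m j)
  calc m j + excess m n i u ≤ m j + excess m n i (m j) := by
        rw [excess_eq, excess_eq]
        linarith [surplus_anti (m i) ((n i : ℝ≥0)⁻¹) hu]
    _ = ∫ θ, ((m j + max (θ i - m j) 0) + ind (θ i) * (θ j - m j)) ∂posterior m n := by
        rw [integral_add_add hc hi hi1, h1]
        simp [excess]
    _ ≤ pairMax m n i j := by
        refine integral_mono ((hc.add hi).add hi1) (integrable_max m n i j) fun θ => ?_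
        simp only [hindd]
        split_ifs with h
        · rw [max_eq_right (by linarith : θ i - m j ≤ 0)]
          linarith [le_max_right (θ i) (θ j)]
        · rw [max_eq_left (by linarith : 0 ≤ θ i - m j)]
          linarith [le_max_left (θ i) (θ j)]

/-- Jensen's inequality against a level below the mean of the first arm. -/
lemma level_le_pairMax {i j : Fin K} (hij : i ≠ j) {u : ℝ} (hu : u ≤ m i) :
    u + excess m n j u ≤ pairMax m n i j := by
  have h := add_excess_le_pairMax m n hij.symm (le_refl (m i))
  rw [pairMax_comm m n j i] at h
  refine le_trans ?_ h
  have hj := integrable_excess m n j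
  -- Lowering the level from `m i` to `u` raises the surplus by at most `m i - u`.
  have h2 : excess m n j u ≤ ∫ θ, ((m i - u) + max (θ j - m i) 0) ∂posterior m n := by
    refine integral_mono (hj u) ((integrable_const _).add (hj _)) fun θ => ?_
    have h1 := le_max_left (θ j - m i) 0
    have h2 := le_max_right (θ j - m i) 0
    exact max_le (by simp only; linarith) (by simp only; linarith)
  rw [integral_add (integrable_const _) (hj _)] at h2
  simp only [integral_const, probReal_univ, one_smul] at h2
  have h3 : excess m n j (m i) = ∫ θ, max (θ j - m i) 0 ∂posterior m n := rfl
  linarith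

/-! ### First-order conditions -/

lemma objective_two (π : Fin K → ℝ) :
    objective 2 (posterior m n) π = ∑ i, ∑ j, π i * π j * pairMax m n i j := by
  have hsup : ∀ (θ : Fin K → ℝ) (A : Fin 2 → Fin K),
      (⨆ k, θ (A k)) = max (θ (A 0)) (θ (A 1)) := by
    intro θ A
    refine le_antisymm (ciSup_le fun k => ?_) (max_le ?_ ?_)
    · fin_cases k <;> simp
    · exact le_ciSup (f := fun k => θ (A k)) (Set.finite_range _).bddAbove 0
    · exact le_ciSup (f := fun k => θ (A k)) (Set.finite_range _).bddAbove 1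
  unfold objective
  simp only [hsup, Fin.prod_univ_two]
  rw [integral_finsetSum _ fun A _ => (integrable_max m n _ _).const_mul _]
  simp only [integral_const_mul]
  rw [← Fintype.sum_prod_type' (f := fun i j => π i * π j * pairMax m n i j)]
  exact Fintype.sum_equiv (finTwoArrowEquiv _) _ _ fun A => rfl

variable {m n}

/-- On the support of a maximizer, the marginal value of an arm is maximal. -/
lemma IsOptimalPolicy.marginal_le {π : Fin K → ℝ} (h : IsOptimalPolicy 2 (posterior m n) π)
    {i : Fin K} (hi : 0 < π i) (k : Fin K) :
    ∑ j, π j * pairMax m n k j ≤ ∑ j, π j * pairMax m n i j := by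
  classical
  obtain ⟨hπ, hmax⟩ := h
  set g : Fin K → ℝ := fun k => ∑ j, π j * pairMax m n k j with hg
  change g k ≤ g i
  by_cases hki : k = i
  · rw [hki]
  -- Moving mass `s` from arm `i` to arm `k` changes the objective by a quadratic in `s` with linear
  -- coefficient `2 * (g k - g i)`.
  set d : Fin K → ℝ := fun j => (if j = k then 1 else 0) - (if j = i then 1 else 0) with hd
  have hsum : ∀ f : Fin K → ℝ, ∑ j, d j * f j = f k - f i := by
    intro f
    simp [hd, sub_mul, Finset.sum_sub_distrib]
  set c : ℝ := ∑ a, ∑ b, d a * d b * pairMax m n a b with hc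
  have hkey : ∀ s : ℝ, 0 ≤ s → s ≤ π i → 2 * s * (g k - g i) + s ^ 2 * c ≤ 0 := by
    intro s hs hs1
    have hmem : (fun j => π j + s * d j) ∈ stdSimplex ℝ (Fin K) := by
      constructor
      · intro j
        simp only [hd]
        have := hπ.1 j
        split_ifs with h1 h2 h2
        · simpa using this
        · linarith
        · subst h2; linarith
        · simpa using this
      · have h1 := hsum fun _ => 1
        simp only [mul_one, sub_self] at h1
        rw [Finset.sum_add_distrib, ← Finset.mul_sum, h1, hπ.2]; simp
    have hle := hmax hmem
    simp only [Set.mem_ofPred_eq, objective_two] at hle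
    have hexp : ∑ a, ∑ b, (π a + s * d a) * (π b + s * d b) * pairMax m n a b =
        ∑ a, ∑ b, π a * π b * pairMax m n a b + 2 * s * (g k - g i) + s ^ 2 * c := by
      have e1 : ∑ a, ∑ b, d a * π b * pairMax m n a b = g k - g i := by
        rw [← hsum g]
        refine Finset.sum_congr rfl fun a _ => ?_
        rw [hg]
        simp only [Finset.mul_sum, mul_assoc]
      have e2 : ∑ a, ∑ b, π a * d b * pairMax m n a b = g k - g i := by
        rw [Finset.sum_comm, ← e1]
        refine Finset.sum_congr rfl fun a _ => Finset.sum_congr rfl fun b _ => ?_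
        rw [pairMax_comm m n b a]; ring
      have e3 : ∀ a b, (π a + s * d a) * (π b + s * d b) * pairMax m n a b =
          π a * π b * pairMax m n a b + s * (d a * π b * pairMax m n a b) +
            s * (π a * d b * pairMax m n a b) + s ^ 2 * (d a * d b * pairMax m n a b) := by
        intro a b; ring
      simp only [e3, Finset.sum_add_distrib, ← Finset.mul_sum]
      rw [e1, e2, ← hc]; ring
    rw [hexp] at hle
    linarith
  by_contra! hlt
  set δ := g k - g i with hδ
  have hδ0 : 0 < δ := sub_pos.2 hlt
  -- Small enough for feasibility and for the linear term to dominate `s ^ 2 * c`.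
  set s := min (π i) (δ / (|c| + 1)) with hs
  have hs0 : 0 < s := lt_min hi (by positivity)
  have h1 := hkey s hs0.le (min_le_left _ _)
  have h2 : s * (|c| + 1) ≤ δ := by
    rw [← le_div_iff₀ (by positivity)]; exact min_le_right _ _
  have h3 : -|c| ≤ c := neg_abs_le c
  nlinarith [mul_pos hs0 hδ0, mul_pos hs0 hs0, mul_le_mul_of_nonneg_left h2 hs0.le,
    mul_le_mul_of_nonneg_left h3 (mul_pos hs0 hs0).le]

end Posterior

/-! ### Consequences of optimality for a single policy -/

section Deterministic

variable {K : ℕ} {m : Fin K → ℝ} {n : Fin K → ℕ}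

lemma excess_le {i : Fin K} (hn : 1 ≤ n i) {u : ℝ} (hu : m i ≤ u) :
    excess m n i u ≤ √((n i : ℝ)⁻¹) * Real.exp (-(n i * (u - m i) ^ 2 / 2)) := by
  have h0 : ((n i : ℝ≥0)⁻¹) ≠ 0 := inv_ne_zero (by positivity)
  have h := surplus_le h0 hu
  rw [excess_eq]
  refine h.trans_eq ?_
  rw [NNReal.coe_inv, NNReal.coe_natCast]
  congr 2
  field_simp

lemma deficit_le {i : Fin K} (hn : 1 ≤ n i) {u : ℝ} (hu : u ≤ m i) :
    deficit m n i u ≤ √((n i : ℝ)⁻¹) * Real.exp (-(n i * (m i - u) ^ 2 / 2)) := by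
  have h0 : ((n i : ℝ≥0)⁻¹) ≠ 0 := inv_ne_zero (by positivity)
  have h := surplus_le (m := -m i) (u := -u) h0 (by linarith)
  rw [deficit_eq]
  refine h.trans_eq ?_
  rw [NNReal.coe_inv, NNReal.coe_natCast]
  congr 2
  field_simp
  ring

lemma sqrt_inv_le_one {k : ℕ} (hk : 1 ≤ k) : √((k : ℝ)⁻¹) ≤ 1 := by
  rw [Real.sqrt_le_one]
  exact inv_le_one_of_one_le₀ (by exact_mod_cast hk)

lemma excess_self_le {i : Fin K} (hn : 1 ≤ n i) : excess m n i (m i) ≤ √((n i : ℝ)⁻¹) := by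
  simpa using excess_le (m := m) hn le_rfl

lemma deficit_le_add {i : Fin K} (hn : 1 ≤ n i) (u : ℝ) :
    deficit m n i u ≤ √((n i : ℝ)⁻¹) + max (u - m i) 0 := by
  have h1 : deficit m n i (m i) ≤ √((n i : ℝ)⁻¹) := by
    simpa using deficit_le (m := m) hn le_rfl
  have h2 : deficit m n i u ≤ ∫ θ, (max (m i - θ i) 0 + max (u - m i) 0) ∂posterior m n := by
    refine integral_mono (integrable_deficit m n i u)
      ((integrable_deficit m n i _).add (integrable_const _)) fun θ => ?_
    have h1 := le_max_left (m i - θ i) 0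
    have h2 := le_max_right (m i - θ i) 0
    have h3 := le_max_left (u - m i) 0
    have h4 := le_max_right (u - m i) 0
    exact max_le (by simp only; linarith) (by simp only; linarith)
  rw [integral_add (integrable_deficit m n i _) (integrable_const _)] at h2
  simp only [integral_const, probReal_univ, one_smul] at h2
  have h3 : deficit m n i (m i) = ∫ θ, max (m i - θ i) 0 ∂posterior m n := rfl
  linarith

/-- The level is `m i`. If `m i ≤ m j`, only the two standard deviations remain. -/
lemma pairMax_sub_le {i j : Fin K} (hi : 1 ≤ n i) (hj : 1 ≤ n j) :
    pairMax m n i j - m j ≤ √((n i : ℝ)⁻¹) + √((n j : ℝ)⁻¹) + max (m i - m j) 0 := by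
  have h1 := pairMax_le m n i j (m i)
  have h2 := excess_self_le (m := m) hi
  have h3 := deficit_le_add (m := m) hj (m i)
  linarith

/-- The level is the midpoint of the means, at distance at least `r / 2` from both; one pull of each
arm suffices. -/
lemma pairMax_sub_le_exp {i j : Fin K} (hi : 1 ≤ n i) (hj : 1 ≤ n j) {r : ℝ} (hr : 0 ≤ r)
    (hij : r ≤ m j - m i) : pairMax m n i j - m j ≤ 2 * Real.exp (-(r ^ 2 / 8)) := by
  have h1 := pairMax_le m n i j ((m i + m j) / 2)
  have h2 := excess_le (m := m) (u := (m i + m j) / 2) hi (by linarith)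
  have h3 := deficit_le (m := m) (u := (m i + m j) / 2) hj (by linarith)
  have hi' : (1 : ℝ) ≤ n i := by exact_mod_cast hi
  have hj' : (1 : ℝ) ≤ n j := by exact_mod_cast hj
  have h4 : ∀ (k : Fin K) (x : ℝ), 1 ≤ n k → r / 2 ≤ x →
      √((n k : ℝ)⁻¹) * Real.exp (-(n k * x ^ 2 / 2)) ≤ Real.exp (-(r ^ 2 / 8)) := by
    intro k x hk hx
    have hk' : (1 : ℝ) ≤ n k := by exact_mod_cast hk
    calc _ ≤ 1 * Real.exp (-(r ^ 2 / 8)) := by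
          refine mul_le_mul (sqrt_inv_le_one hk) (Real.exp_le_exp.2 ?_) (Real.exp_pos _).le zero_le_one
          have : (r / 2) ^ 2 ≤ x ^ 2 := by gcongr
          nlinarith [sq_nonneg x]
      _ = _ := one_mul _
  have h5 := h4 i ((m i + m j) / 2 - m i) hi (by linarith)
  have h6 := h4 j (m j - (m i + m j) / 2) hj (by linarith)
  linarith

/-- The probability of an arm whose posterior mean lies below that of the arm `o`. -/
lemma IsOptimalPolicy.mul_sub_le {π : Fin K → ℝ} (h : IsOptimalPolicy 2 (posterior m n) π)
    {i o : Fin K} (hio : i ≠ o) {u : ℝ} (hu : u ≤ m o) :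
    π i * (m o - m i) ≤ excess m n i u + π o * deficit m n o u := by
  have hπ := h.1
  have hE := excess_nonneg m n i u
  have hD := mul_nonneg (hπ.1 o) (deficit_nonneg m n o u)
  rcases (hπ.1 i).eq_or_lt' with hi | hi
  · rw [hi]; linarith
  have hle := h.marginal_le hi o
  have hterm : ∀ j, π j * pairMax m n i j - π j * pairMax m n o j ≤
      π j * excess m n i u + (if j = o then π o * deficit m n o u else 0)
        - (if j = i then π i * (m o - m i) else 0) := by
    intro j
    have hj := hπ.1 j
    by_cases h1 : j = o
    · subst h1
      have h2 := mul_le_mul_of_nonneg_left (pairMax_le m n i j u) hj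
      simp only [if_true, if_neg hio.symm, pairMax_self]
      linarith
    · by_cases h2 : j = i
      · subst h2
        have h3 := mul_le_mul_of_nonneg_left (le_pairMax_right m n j o) hj
        rw [pairMax_comm m n j o] at h3
        simp only [if_true, if_neg hio, pairMax_self]
        have h4 := mul_nonneg hj hE
        linarith
      · simp only [if_neg h1, if_neg h2]
        -- The quantity `u + excess m n j u` enters the upper bound for the pair `(i, j)` and the
        -- lower bound for `(o, j)`, so a third arm `j` cancels whatever its posterior.
        have h3 := mul_le_mul_of_nonneg_left (pairMax_le_level m n i j u) hj
        have h4 := mul_le_mul_of_nonneg_left (level_le_pairMax m n (Ne.symm h1) hu) hj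
        linarith
  have hs := Finset.sum_le_sum fun j (_ : j ∈ Finset.univ) => hterm j
  simp only [Finset.sum_sub_distrib, Finset.sum_add_distrib, Finset.sum_ite_eq', Finset.mem_univ,
    if_true, ← Finset.sum_mul, hπ.2] at hs
  linarith

/-- Lower bound for the marginal value of the arm `o`. -/
lemma sum_mul_excess_le {π : Fin K → ℝ} (hπ : ∀ j, 0 ≤ π j) {o : Fin K} {u : ℝ}
    (S : Finset (Fin K)) (hS : ∀ j ∈ S, j ≠ o ∧ m j ≤ u) :
    (∑ j ∈ S, π j) * excess m n o u ≤ ∑ j, π j * (pairMax m n o j - m j) := by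
  rw [Finset.sum_mul]
  calc ∑ j ∈ S, π j * excess m n o u ≤ ∑ j ∈ S, π j * (pairMax m n o j - m j) := by
        refine Finset.sum_le_sum fun j hj => mul_le_mul_of_nonneg_left ?_ (hπ j)
        linarith [add_excess_le_pairMax m n (hS j hj).1.symm (hS j hj).2]
    _ ≤ _ := Finset.sum_le_univ_sum_of_nonneg fun j =>
        mul_nonneg (hπ j) (by linarith [le_pairMax_right m n o j])

/-- If the common marginal value on the support of `π` is at least `η`, then `π` puts mass on the
arms with few pulls. -/
lemma le_mul_sum_few_pulls {π : Fin K → ℝ} (hπ : π ∈ stdSimplex ℝ (Fin K)) (hn : ∀ i, 1 ≤ n i)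
    {η : ℝ} (hη : 0 < η) (hη1 : η ≤ 1)
    (hval : ∀ i, 0 < π i → η ≤ ∑ j, π j * (pairMax m n i j - m j)) :
    η ≤ (4 + 16 * Real.log (4 / η)) *
      ∑ i ∈ Finset.univ.filter (fun i => (n i : ℝ) ≤ 16 / η ^ 2), π i := by
  classical
  set L := Finset.univ.filter (fun i => (n i : ℝ) ≤ 16 / η ^ 2) with hL
  set p := ∑ i ∈ L, π i with hp
  have hp0 : 0 ≤ p := Finset.sum_nonneg fun i _ => hπ.1 i
  set σ : Fin K → ℝ := fun i => √((n i : ℝ)⁻¹) with hσ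
  have hσ1 : ∀ i, σ i ≤ 1 := fun i => sqrt_inv_le_one (hn i)
  have hσ0 : ∀ i, 0 ≤ σ i := fun i => Real.sqrt_nonneg _
  have hσL : ∀ i, i ∉ L → σ i ≤ η / 4 := by
    intro i hi
    simp only [hL, Finset.mem_filter, Finset.mem_univ, true_and, not_le] at hi
    refine Real.sqrt_le_iff.2 ⟨by positivity, ?_⟩
    rw [inv_le_comm₀ (by exact_mod_cast hn i) (by positivity)]
    refine le_trans (le_of_eq ?_) hi.le
    field_simp
    norm_num
  have hlog : 1 ≤ Real.log (4 / η) := by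
    rw [Real.le_log_iff_exp_le (by positivity), le_div_iff₀ hη]
    have := Real.exp_one_lt_d9
    nlinarith [Real.exp_pos 1]
  -- A distance `r` between means makes the bound of `pairMax_sub_le_exp` at most `η / 2`; this uses
  -- `log (4 / η) ≥ 1`.
  set r := 8 * Real.log (4 / η) with hr
  have hr0 : 0 ≤ r := by positivity
  have hR : 4 + 2 * r = 4 + 16 * Real.log (4 / η) := by rw [hr]; ring
  rw [← hR]
  have hexp : Real.exp (-(r ^ 2 / 8)) ≤ η / 4 := by
    rw [← Real.exp_log (show 0 < η / 4 by positivity)]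
    refine Real.exp_le_exp.2 ?_
    have : Real.log (η / 4) = -Real.log (4 / η) := by rw [← Real.log_inv, inv_div]
    rw [this, hr]
    nlinarith
  -- averages over `π` split along `L`
  have hsplit : ∀ (f : Fin K → ℝ) (x y : ℝ), (∀ j ∈ L, 0 < π j → f j ≤ x) →
      (∀ j, j ∉ L → 0 < π j → f j ≤ y) → 0 ≤ y → ∑ j, π j * f j ≤ p * x + y := by
    intro f x y hx hy hy0
    rw [← Finset.sum_add_sum_compl L]
    refine add_le_add ?_ ?_
    · rw [hp, Finset.sum_mul]
      refine Finset.sum_le_sum fun j hj => ?_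
      rcases (hπ.1 j).eq_or_lt' with h | h
      · simp [h]
      · exact mul_le_mul_of_nonneg_left (hx j hj h) h.le
    · calc ∑ j ∈ Lᶜ, π j * f j ≤ ∑ j ∈ Lᶜ, π j * y := by
            refine Finset.sum_le_sum fun j hj => ?_
            rcases (hπ.1 j).eq_or_lt' with h | h
            · simp [h]
            · exact mul_le_mul_of_nonneg_left (hy j (by simpa using hj) h) h.le
        _ ≤ ∑ j, π j * y := Finset.sum_le_univ_sum_of_nonneg fun j => mul_nonneg (hπ.1 j) hy0
        _ = y := by rw [← Finset.sum_mul, hπ.2, one_mul]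
  set S := Finset.univ.filter (fun i => 0 < π i) with hS
  have hmemS : ∀ i, i ∈ S ↔ 0 < π i := by simp [hS]
  have hSne : S.Nonempty := by
    rw [Finset.nonempty_iff_ne_empty]
    intro he
    have h0 : ∀ i, π i = 0 := fun i => by
      have : i ∉ S := by simp [he]
      rw [hmemS] at this
      exact le_antisymm (not_lt.1 this) (hπ.1 i)
    have := hπ.2
    simp [h0] at this
  -- Arm `a` has the lowest posterior mean in the support, and arm `b` below the lowest among
  -- support arms outside `L`. If they are within `r`, the marginal value of `b` gains at most `2 +
  -- r` against arms in `L` and `η / 2` against the others. If not, the marginal value of `a` gains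
  -- at most `2` and `η / 2`. If `b` does not exist, `p = 1`.
  obtain ⟨a, haS, ha⟩ := S.exists_min_image m hSne
  have hva := hval a ((hmemS a).1 haS)
  by_cases hT : (S \ L).Nonempty
  · obtain ⟨b, hbT, hb⟩ := (S \ L).exists_min_image m hT
    obtain ⟨hbS, hbL⟩ := Finset.mem_sdiff.1 hbT
    have hvb := hval b ((hmemS b).1 hbS)
    have hab := ha b hbS
    rcases le_or_gt (m b - m a) r with hle | hgt
    · have h := hsplit (fun j => pairMax m n b j - m j) (2 + r) (η / 2) ?_ ?_ (by positivity)
      · nlinarith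
      · intro j _ hj
        have h1 := pairMax_sub_le (m := m) (hn b) (hn j)
        have h2 := ha j ((hmemS j).2 hj)
        have h3 : max (m b - m j) 0 ≤ r := max_le (by linarith) hr0
        have := hσ1 b
        have := hσ1 j
        simp only [hσ] at *
        linarith
      · intro j hjL hj
        have h1 := pairMax_sub_le (m := m) (hn b) (hn j)
        have h2 := hb j (Finset.mem_sdiff.2 ⟨(hmemS j).2 hj, hjL⟩)
        have h3 : max (m b - m j) 0 = 0 := max_eq_right (by linarith)
        have := hσL b hbL
        have := hσL j hjL
        simp only [hσ] at *
        linarith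
    · have h := hsplit (fun j => pairMax m n a j - m j) 2 (η / 2) ?_ ?_ (by positivity)
      · nlinarith
      · intro j _ hj
        have h1 := pairMax_sub_le (m := m) (hn a) (hn j)
        have h2 := ha j ((hmemS j).2 hj)
        have h3 : max (m a - m j) 0 = 0 := max_eq_right (by linarith)
        have := hσ1 a
        have := hσ1 j
        simp only [hσ] at *
        linarith
      · intro j hjL hj
        have h2 := hb j (Finset.mem_sdiff.2 ⟨(hmemS j).2 hj, hjL⟩)
        have h1 := pairMax_sub_le_exp (m := m) (hn a) (hn j) hr0 (by linarith)
        linarith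
  · have h1 : p = 1 := by
      rw [← hπ.2, hp]
      refine Finset.sum_subset (Finset.subset_univ _) fun i _ hi => ?_
      by_contra h0
      exact hT ⟨i, Finset.mem_sdiff.2 ⟨(hmemS i).2 (lt_of_le_of_ne (hπ.1 i) (Ne.symm h0)), hi⟩⟩
    rw [h1]
    linarith

end Deterministic

section Run

variable {Ω : Type*} {K : ℕ}

/-! ### Counting pulls -/

lemma pulls_zero (I : ℕ → Ω → Fin K) (i : Fin K) (ω : Ω) : pulls I i 0 ω = 0 := by
  simp [pulls]

lemma pulls_succ (I : ℕ → Ω → Fin K) (i : Fin K) (t : ℕ) (ω : Ω) :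
    pulls I i (t + 1) ω = pulls I i t ω + if I t ω = i then 1 else 0 := by
  unfold pulls
  rw [Finset.range_add_one, Finset.filter_insert]
  split_ifs with h
  · rw [Finset.card_insert_of_notMem (by simp)]
  · simp

lemma pulls_mono (I : ℕ → Ω → Fin K) (i : Fin K) (ω : Ω) : Monotone fun t => pulls I i t ω :=
  monotone_nat_of_le_succ fun t => by rw [pulls_succ]; exact Nat.le_add_right _ _

lemma pulls_le (I : ℕ → Ω → Fin K) (i : Fin K) (t : ℕ) (ω : Ω) : pulls I i t ω ≤ t :=
  (Finset.card_filter_le _ _).trans (by simp)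

/-- The indicator of the event that arm `i` is pulled in round `t`. -/
noncomputable def hit (I : ℕ → Ω → Fin K) (t : ℕ) (i : Fin K) : Ω → ℝ :=
  (I t ⁻¹' {i}).indicator fun _ => (1 : ℝ)

lemma hit_eq (I : ℕ → Ω → Fin K) (t : ℕ) (i : Fin K) (ω : Ω) :
    hit I t i ω = if I t ω = i then 1 else 0 := by
  by_cases h : I t ω = i <;> simp [hit, h]

lemma hit_nonneg (I : ℕ → Ω → Fin K) (t : ℕ) (i : Fin K) (ω : Ω) : 0 ≤ hit I t i ω := by
  rw [hit_eq]; split_ifs <;> norm_num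

lemma hit_le_one (I : ℕ → Ω → Fin K) (t : ℕ) (i : Fin K) (ω : Ω) : hit I t i ω ≤ 1 := by
  rw [hit_eq]; split_ifs <;> norm_num

/-- The counter rises by one at each pull, so the pulls meet the sample sizes `0, 1, …` once each.
This converts sums over time into sums over sample sizes. -/
lemma sum_range_mul_hit (I : ℕ → Ω → Fin K) (i : Fin K) (f : ℕ → ℝ) (T : ℕ) (ω : Ω) :
    ∑ t ∈ Finset.range T, f (pulls I i t ω) * hit I t i ω =
      ∑ k ∈ Finset.range (pulls I i T ω), f k := by
  induction T with
  | zero => simp [pulls_zero]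
  | succ T ih =>
    rw [Finset.sum_range_succ, ih, pulls_succ, hit_eq]
    split_ifs
    · rw [Finset.sum_range_succ, mul_one]
    · simp

/-- Between the rounds `K` and `T`, every number of earlier pulls occurs at most once among the
pulls of an arm. -/
lemma sum_Ico_mul_hit_le (I : ℕ → Ω → Fin K) (i : Fin K) {f : ℕ → ℝ} (hf : ∀ k, 0 ≤ f k) (T : ℕ)
    {ω : Ω} (h1 : 1 ≤ pulls I i K ω) :
    ∑ t ∈ Finset.Ico K T, f (pulls I i t ω) * hit I t i ω ≤ ∑ k ∈ Finset.Ico 1 T, f k := by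
  rcases le_or_gt K T with hKT | hKT
  · rw [Finset.sum_Ico_eq_sub _ hKT, sum_range_mul_hit, sum_range_mul_hit,
      ← Finset.sum_Ico_eq_sub _ (pulls_mono I i ω hKT)]
    refine Finset.sum_le_sum_of_subset_of_nonneg ?_ fun k _ _ => hf k
    exact Finset.Ico_subset_Ico h1 (pulls_le I i T ω)
  · rw [Finset.Ico_eq_empty (by omega), Finset.sum_empty]
    exact Finset.sum_nonneg fun k _ => hf k

/-- The mean of the first `k` rewards of arm `i`. -/
noncomputable def avg (X : Fin K → ℕ → Ω → ℝ) (i : Fin K) (k : ℕ) (ω : Ω) : ℝ :=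
  (∑ l ∈ Finset.range k, X i l ω) / k

lemma sum_sub_eq (X : Fin K → ℕ → Ω → ℝ) (μ : Fin K → ℝ) (i : Fin K) {k : ℕ} (hk : 1 ≤ k) (ω : Ω) :
    ∑ l ∈ Finset.range k, (X i l ω - μ i) = k * (avg X i k ω - μ i) := by
  have : (k : ℝ) ≠ 0 := by positivity
  rw [Finset.sum_sub_distrib, avg]
  field_simp
  simp

/-- Rewards are read in a fixed order, so the policy influences an empirical mean only through the
number of pulls. Deviation events can thus be stated for deterministic sample sizes. -/
lemma empMean_eq (X : Fin K → ℕ → Ω → ℝ) (I : ℕ → Ω → Fin K) (i : Fin K) (t : ℕ) (ω : Ω) :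
    empMean X I i t ω = avg X i (pulls I i t ω) ω := by
  unfold empMean avg
  congr 1
  have h := sum_range_mul_hit I i (fun k => X i k ω) t ω
  rw [← h, Finset.sum_filter]
  refine Finset.sum_congr rfl fun s _ => ?_
  rw [hit_eq]
  split_ifs with hs
  · simp [reward, hs]
  · simp

/-! ### Measurability with respect to the past -/

lemma measurable_past_reward (X : Fin K → ℕ → Ω → ℝ) (I : ℕ → Ω → Fin K) (t : ℕ) (i : Fin K)
    (k : ℕ) : Measurable[past X I t] (X i k) := by
  refine Measurable.of_comap_le ?_
  exact le_sup_of_le_left (le_iSup_of_le i (le_iSup_of_le k le_rfl))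

lemma measurable_past_arm (X : Fin K → ℕ → Ω → ℝ) (I : ℕ → Ω → Fin K) {s t : ℕ} (hs : s < t) :
    Measurable[past X I t] (I s) := by
  refine Measurable.of_comap_le ?_
  exact le_sup_of_le_right (le_iSup_of_le s (le_iSup_of_le (Finset.mem_range.2 hs) le_rfl))

lemma measurable_past_avg (X : Fin K → ℕ → Ω → ℝ) (I : ℕ → Ω → Fin K) (t : ℕ) (i : Fin K)
    (k : ℕ) : Measurable[past X I t] (avg X i k) := by
  let _ := past X I t
  exact (Finset.measurable_fun_sum _ fun l _ => measurable_past_reward X I t i l).div_const _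

lemma measurable_past_pulls (X : Fin K → ℕ → Ω → ℝ) (I : ℕ → Ω → Fin K) (t : ℕ) (i : Fin K) :
    Measurable[past X I t] (pulls I i t) := by
  let _ := past X I t
  have : pulls I i t = fun ω => ∑ s ∈ Finset.range t, if I s ω = i then 1 else 0 := by
    ext ω
    exact Finset.card_filter _ _
  rw [this]
  refine Finset.measurable_fun_sum _ fun s hs => Measurable.ite ?_ measurable_const measurable_const
  exact measurable_past_arm X I (Finset.mem_range.1 hs) (measurableSet_singleton i)

lemma measurable_past_empMean (X : Fin K → ℕ → Ω → ℝ) (I : ℕ → Ω → Fin K) (t : ℕ) (i : Fin K) :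
    Measurable[past X I t] (empMean X I i t) := by
  let _ := past X I t
  have h1 : Measurable fun q : ℕ × Ω => avg X i q.1 q.2 :=
    measurable_from_prod_countable_right fun k => measurable_past_avg X I t i k
  have h2 := h1.comp ((measurable_past_pulls X I t i).prodMk measurable_id)
  convert h2 using 1
  ext ω
  exact empMean_eq X I i t ω

variable [MeasurableSpace Ω] {P : Measure Ω} {M : ℕ} {μ : Fin K → ℝ}
  {X : Fin K → ℕ → Ω → ℝ} {I : ℕ → Ω → Fin K}

/-- The conditional probability of pulling arm `i` in round `t`. -/
noncomputable def policy (P : Measure Ω) (X : Fin K → ℕ → Ω → ℝ) (I : ℕ → Ω → Fin K) (t : ℕ)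
    (i : Fin K) : Ω → ℝ :=
  condExp (past X I t) P (hit I t i)

namespace IsRun

lemma past_le (h : IsRun P M μ X I) (t : ℕ) : past X I t ≤ ‹MeasurableSpace Ω› := by
  refine sup_le (iSup_le fun i => iSup_le fun k => (h.measurable_reward i k).comap_le)
    (iSup_le fun s => iSup_le fun _ => (h.measurable_arm s).comap_le)

lemma measurable_pulls (h : IsRun P M μ X I) (i : Fin K) (t : ℕ) : Measurable (pulls I i t) :=
  (measurable_past_pulls X I t i).mono (h.past_le t) le_rfl

lemma measurable_hit (h : IsRun P M μ X I) (t : ℕ) (i : Fin K) : Measurable (hit I t i) :=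
  measurable_const.indicator (h.measurable_arm t (measurableSet_singleton i))

lemma integrable_hit [IsProbabilityMeasure P] (h : IsRun P M μ X I) (t : ℕ) (i : Fin K) : Integrable (hit I t i) P :=
  Integrable.of_bound (h.measurable_hit t i).aestronglyMeasurable 1 (ae_of_all _ fun ω => by
    rw [Real.norm_of_nonneg (hit_nonneg _ _ _ _)]; exact hit_le_one _ _ _ _)

lemma integrable_bdd_mul_hit [IsProbabilityMeasure P] (h : IsRun P M μ X I) (t : ℕ) (i : Fin K) {H : Ω → ℝ}
    (hH : Measurable[past X I t] H) {c : ℝ} (hc : ∀ ω, |H ω| ≤ c) :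
    Integrable (fun ω => H ω * hit I t i ω) P :=
  (h.integrable_hit t i).bdd_mul (c := c) (hH.mono (h.past_le t) le_rfl).aestronglyMeasurable
    (ae_of_all _ hc)

lemma integrable_bdd_mul_policy [IsProbabilityMeasure P] (h : IsRun P M μ X I) (t : ℕ) (i : Fin K) {H : Ω → ℝ}
    (hH : Measurable[past X I t] H) {c : ℝ} (hc : ∀ ω, |H ω| ≤ c) :
    Integrable (fun ω => H ω * policy P X I t i ω) P :=
  integrable_condExp.bdd_mul (c := c) (hH.mono (h.past_le t) le_rfl).aestronglyMeasurable
    (ae_of_all _ hc)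

/-- Arms are drawn from the conditional probabilities. -/
lemma integral_mul_policy [IsProbabilityMeasure P] (h : IsRun P M μ X I) (t : ℕ) (i : Fin K) {H : Ω → ℝ}
    (hH : Measurable[past X I t] H) {c : ℝ} (hc : ∀ ω, |H ω| ≤ c) :
    ∫ ω, H ω * policy P X I t i ω ∂P = ∫ ω, H ω * hit I t i ω ∂P := by
  have h1 := condExp_mul_of_stronglyMeasurable_left (μ := P) (f := H) (g := hit I t i)
    hH.stronglyMeasurable (h.integrable_bdd_mul_hit t i hH hc) (h.integrable_hit t i)
  have h2 := integral_condExp (h.past_le t) (μ := P) (f := H * hit I t i)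
  rw [integral_congr_ae h1] at h2
  exact h2

lemma ae_one_le_pulls (h : IsRun P M μ X I) : ∀ᵐ ω ∂P, ∀ i t, K ≤ t → 1 ≤ pulls I i t ω := by
  have h1 : ∀ᵐ ω ∂P, ∀ t : Fin K, I t ω = t :=
    ae_all_iff.2 fun t => h.initial t t.2
  filter_upwards [h1] with ω hω i t ht
  unfold pulls
  rw [Nat.one_le_iff_ne_zero, Finset.card_ne_zero]
  exact ⟨i, by simpa [hω i] using lt_of_lt_of_le i.2 ht⟩

lemma ae_isOptimal (h : IsRun P M μ X I) : ∀ᵐ ω ∂P, ∀ t, K ≤ t →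
    IsOptimalPolicy M (posterior (fun i => empMean X I i t ω) (fun i => pulls I i t ω))
      (fun i => policy P X I t i ω) := by
  rw [ae_all_iff]
  intro t
  by_cases ht : K ≤ t
  · filter_upwards [h.arm_law t ht] with ω hω _
    exact hω
  · exact ae_of_all _ fun ω h => absurd h ht

/-! ### Deviations of the empirical means -/

lemma hasSubgaussianMGF (h : IsRun P M μ X I) (i : Fin K) (k : ℕ) :
    HasSubgaussianMGF (fun ω => X i k ω - μ i) 1 P := by
  have hlaw : HasLaw (X i k) (gaussianReal (μ i) 1) P :=
    ⟨(h.measurable_reward i k).aemeasurable, h.reward_law i k⟩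
  have h1 := (gaussianReal_sub_const hlaw (μ i)).map_eq
  rw [sub_self] at h1
  have hm : AEMeasurable (fun ω => X i k ω - μ i) P :=
    ((h.measurable_reward i k).sub_const _).aemeasurable
  constructor
  · intro t
    have h2 := integrable_exp_mul_gaussianReal (μ := 0) (v := 1) t
    rw [← h1] at h2
    exact h2.comp_aemeasurable hm
  · intro t
    rw [mgf_gaussianReal h1]
    simp

lemma iIndepFun_arm (h : IsRun P M μ X I) (i : Fin K) :
    iIndepFun (fun k ω => X i k ω - μ i) P := by
  have h1 : iIndepFun (fun k => X i k) P :=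
    h.reward_indep.precomp (g := fun k : ℕ => (i, k)) fun a b hab => (Prod.mk.inj hab).2
  exact h1.comp (fun _ x => x - μ i) fun _ => by fun_prop

lemma avg_upper_tail [IsProbabilityMeasure P] (h : IsRun P M μ X I) (i : Fin K) {k : ℕ} (hk : 1 ≤ k) {a : ℝ} (ha : 0 ≤ a) :
    P.real {ω | μ i + a ≤ avg X i k ω} ≤ Real.exp (-(k * a ^ 2 / 2)) := by
  have hk' : (0 : ℝ) < k := by positivity
  have h1 := HasSubgaussianMGF.measure_sum_range_ge_le_of_iIndepFun (h.iIndepFun_arm i) (n := k)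
    (fun l _ => h.hasSubgaussianMGF i l) (ε := k * a) (by positivity)
  convert h1 using 2
  · congr 1
    ext ω
    rw [sum_sub_eq X μ i hk, mul_le_mul_iff_right₀ hk']
    constructor <;> intro h <;> linarith
  · simp
    field_simp

lemma avg_lower_tail [IsProbabilityMeasure P] (h : IsRun P M μ X I) (i : Fin K) {k : ℕ} (hk : 1 ≤ k) {a : ℝ} (ha : 0 ≤ a) :
    P.real {ω | avg X i k ω ≤ μ i - a} ≤ Real.exp (-(k * a ^ 2 / 2)) := by
  have hk' : (0 : ℝ) < k := by positivity
  have h1 := HasSubgaussianMGF.measure_sum_range_ge_le_of_iIndepFun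
    ((h.iIndepFun_arm i).comp (fun _ x => -x) fun _ => by fun_prop) (n := k)
    (fun l _ => (h.hasSubgaussianMGF i l).neg) (ε := k * a) (by positivity)
  convert h1 using 2
  · congr 1
    ext ω
    simp only [Function.comp]
    rw [Finset.sum_neg_distrib, sum_sub_eq X μ i hk, ← mul_neg, mul_le_mul_iff_right₀ hk']
    constructor <;> intro h <;> linarith
  · simp
    field_simp

end IsRun

end Run

/-! ### Elementary sums -/

lemma sum_exp_neg_le {a : ℝ} (ha : 0 < a) (T : ℕ) :
    ∑ k ∈ Finset.Ico 1 T, Real.exp (-(k * a)) ≤ 1 / a := by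
  -- The numerator makes the induction telescope, by `exp a - 1 ≥ a`.
  have key : ∀ T : ℕ, ∑ k ∈ Finset.Ico 1 (T + 1), Real.exp (-(k * a)) ≤
      (1 - Real.exp (-(T * a))) / a := by
    intro T
    induction T with
    | zero => simp
    | succ T ih =>
      rw [Finset.sum_Ico_succ_top (by omega)]
      have h1 : Real.exp (-(T * a)) = Real.exp (-((T + 1 : ℕ) * a)) * Real.exp a := by
        rw [← Real.exp_add]; push_cast; ring_nf
      have h2 := Real.add_one_le_exp a
      have h3 := Real.exp_pos (-((T + 1 : ℕ) * a))
      have h4 : (1 - Real.exp (-(T * a))) / a + Real.exp (-((T + 1 : ℕ) * a)) ≤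
          (1 - Real.exp (-((T + 1 : ℕ) * a))) / a := by
        rw [div_add' _ _ _ ha.ne']
        refine div_le_div_of_nonneg_right ?_ ha.le
        rw [h1]
        nlinarith
      linarith
  rcases T with _ | T
  · simp [ha.le]
  · refine (key T).trans (div_le_div_of_nonneg_right ?_ ha.le)
    linarith [Real.exp_pos (-(T * a))]

/-- Half of the exponent absorbs the root: `√(k a) ≤ exp (k a / 2)`. -/
lemma sum_sqrt_mul_exp_neg_le {a : ℝ} (ha : 0 < a) (T : ℕ) :
    ∑ k ∈ Finset.Ico 1 T, √(k : ℝ) * Real.exp (-(k * a)) ≤ 2 / (a * √a) := by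
  have hs : 0 < √a := Real.sqrt_pos.2 ha
  calc ∑ k ∈ Finset.Ico 1 T, √(k : ℝ) * Real.exp (-(k * a))
      ≤ ∑ k ∈ Finset.Ico 1 T, (1 / √a) * Real.exp (-(k * (a / 2))) := by
        refine Finset.sum_le_sum fun k _ => ?_
        have h1 : √(k : ℝ) * √a ≤ Real.exp (k * (a / 2)) := by
          rw [← Real.sqrt_mul (by positivity)]
          refine Real.sqrt_le_iff.2 ⟨(Real.exp_pos _).le, ?_⟩
          rw [← Real.exp_nat_mul]
          have := Real.add_one_le_exp (k * a)
          have e : ((2 : ℕ) : ℝ) * (k * (a / 2)) = k * a := by push_cast; ring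
          rw [e]; linarith
        have h2 : Real.exp (-(k * a)) = Real.exp (-(k * (a / 2))) * Real.exp (-(k * (a / 2))) := by
          rw [← Real.exp_add]; ring_nf
        have h3 : Real.exp (k * (a / 2)) * Real.exp (-(k * (a / 2))) = 1 := by
          rw [← Real.exp_add]; simp
        have h4 : √(k : ℝ) ≤ Real.exp (k * (a / 2)) * (1 / √a) := by
          rw [mul_one_div, le_div_iff₀ hs]; exact h1
        calc √(k : ℝ) * Real.exp (-(k * a))
            ≤ (Real.exp (k * (a / 2)) * (1 / √a)) * Real.exp (-(k * a)) := by gcongr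
          _ = (1 / √a) * (Real.exp (k * (a / 2)) * Real.exp (-(k * (a / 2)))) *
              Real.exp (-(k * (a / 2))) := by rw [h2]; ring
          _ = _ := by rw [h3, mul_one]
    _ ≤ (1 / √a) * (1 / (a / 2)) := by
        rw [← Finset.mul_sum]
        exact mul_le_mul_of_nonneg_left (sum_exp_neg_le (by positivity) T) (by positivity)
    _ = 2 / (a * √a) := by field_simp

lemma card_Ico_filter_le {r : ℝ} (hr : 0 ≤ r) (T : ℕ) :
    (((Finset.Ico 1 T).filter fun k : ℕ => (k : ℝ) ≤ r).card : ℝ) ≤ r := by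
  have h : (Finset.Ico 1 T).filter (fun k : ℕ => (k : ℝ) ≤ r) ⊆ Finset.Icc 1 ⌊r⌋₊ := by
    intro k hk
    rw [Finset.mem_filter, Finset.mem_Ico] at hk
    exact Finset.mem_Icc.2 ⟨hk.1.1, Nat.le_floor hk.2⟩
  calc _ ≤ ((Finset.Icc 1 ⌊r⌋₊).card : ℝ) := by exact_mod_cast Finset.card_le_card h
    _ = ⌊r⌋₊ := by simp
    _ ≤ r := Nat.floor_le hr

/-! ### Charging rounds to sample sizes -/

section Run

variable {Ω : Type*} {K : ℕ}

lemma measurable_past_comp_pulls {X : Fin K → ℕ → Ω → ℝ} {I : ℕ → Ω → Fin K} {t : ℕ}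
    (i : Fin K) {f : ℕ → Ω → ℝ} (hf : ∀ k, Measurable[past X I t] (f k)) :
    Measurable[past X I t] fun ω => f (pulls I i t ω) ω := by
  let _ := past X I t
  have h1 : Measurable fun q : ℕ × Ω => f q.1 q.2 := measurable_from_prod_countable_right hf
  exact h1.comp ((measurable_past_pulls X I t i).prodMk measurable_id)

variable [MeasurableSpace Ω] {P : Measure Ω} {M : ℕ} {μ : Fin K → ℝ}
  {X : Fin K → ℕ → Ω → ℝ} {I : ℕ → Ω → Fin K}

namespace IsRun

lemma measurable_comp_pulls (h : IsRun P M μ X I) (t : ℕ) (i : Fin K) {f : ℕ → Ω → ℝ}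
    (hf : ∀ k, Measurable (f k)) : Measurable fun ω => f (pulls I i t ω) ω := by
  have h1 : Measurable fun q : ℕ × Ω => f q.1 q.2 := measurable_from_prod_countable_right hf
  exact h1.comp ((h.measurable_pulls i t).prodMk measurable_id)

/-- Expected total weight of the pulls of an arm, when the weight of a pull depends on the number
of earlier pulls. -/
lemma sum_integral_comp_pulls_le [IsProbabilityMeasure P] (h : IsRun P M μ X I) (i : Fin K) {f : ℕ → Ω → ℝ} {c : ℝ}
    (hf : ∀ k, Measurable (f k)) (h0 : ∀ k ω, 0 ≤ f k ω) (h1 : ∀ k ω, f k ω ≤ c) (T : ℕ) :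
    ∑ t ∈ Finset.Ico K T, ∫ ω, f (pulls I i t ω) ω * hit I t i ω ∂P ≤
      ∑ k ∈ Finset.Ico 1 T, ∫ ω, f k ω ∂P := by
  have hint : ∀ k, Integrable (f k) P := fun k =>
    Integrable.of_bound (hf k).aestronglyMeasurable c (ae_of_all _ fun ω => by
      rw [Real.norm_of_nonneg (h0 k ω)]; exact h1 k ω)
  have hint2 : ∀ t, Integrable (fun ω => f (pulls I i t ω) ω * hit I t i ω) P := fun t =>
    (h.integrable_hit t i).bdd_mul (c := c) (h.measurable_comp_pulls t i hf).aestronglyMeasurable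
      (ae_of_all _ fun ω => by rw [Real.norm_of_nonneg (h0 _ ω)]; exact h1 _ ω)
  rw [← integral_finsetSum _ fun t _ => hint2 t, ← integral_finsetSum _ fun k _ => hint k]
  refine integral_mono_ae (integrable_finsetSum _ fun t _ => hint2 t)
    (integrable_finsetSum _ fun k _ => hint k) ?_
  filter_upwards [h.ae_one_le_pulls] with ω hω
  exact sum_Ico_mul_hit_le I i (f := fun k => f k ω) (fun k => h0 k ω) T (hω i K le_rfl)

/-- Expected number of pulls at a sample size where an event on the rewards of that size holds. -/
lemma sum_integral_indicator_le [IsProbabilityMeasure P] (h : IsRun P M μ X I) (i : Fin K) {S : ℕ → Set Ω}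
    (hS : ∀ k, MeasurableSet (S k)) (T : ℕ) :
    ∑ t ∈ Finset.Ico K T, ∫ ω, (S (pulls I i t ω)).indicator (fun _ => (1 : ℝ)) ω * hit I t i ω ∂P
      ≤ ∑ k ∈ Finset.Ico 1 T, P.real (S k) := by
  refine (h.sum_integral_comp_pulls_le i (f := fun k => (S k).indicator fun _ => (1 : ℝ)) (c := 1)
    (fun k => measurable_const.indicator (hS k)) (fun k ω => ?_) (fun k ω => ?_) T).trans_eq ?_
  · exact Set.indicator_nonneg (fun _ _ => zero_le_one) _
  · exact Set.indicator_le_self' (fun _ _ => zero_le_one) _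
  · refine Finset.sum_congr rfl fun k _ => ?_
    rw [integral_indicator (hS k)]
    simp [Measure.real]

end IsRun

end Run

/-- The factor that converts a marginal value into a probability of pulling an arm with few
pulls. -/
noncomputable def logFactor (η : ℝ) : ℝ := 4 + 16 * Real.log (4 / η)

lemma logFactor_pos {η : ℝ} (h0 : 0 < η) (h1 : η ≤ 1) : 0 < logFactor η := by
  have : 0 ≤ Real.log (4 / η) := Real.log_nonneg (by rw [le_div_iff₀ h0]; linarith)
  unfold logFactor
  positivity

/-- The mass `1/4` on `S` times the surplus `4 * η` gives arm `o` a marginal gain of at least `η`;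
by optimality every arm in the support has at least this gain, as `le_mul_sum_few_pulls` requires.
-/
lemma IsOptimalPolicy.le_logFactor_mul {K : ℕ} {m : Fin K → ℝ} {n : Fin K → ℕ} {π : Fin K → ℝ}
    (h : IsOptimalPolicy 2 (posterior m n) π) (hn : ∀ i, 1 ≤ n i) {o : Fin K} {u η : ℝ}
    (S : Finset (Fin K)) (hS : ∀ j ∈ S, j ≠ o ∧ m j ≤ u) (hmass : 1 / 4 ≤ ∑ j ∈ S, π j)
    (hη : 0 < η) (hη1 : η ≤ 1) (hu : 4 * η ≤ excess m n o u) :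
    η ≤ logFactor η * ∑ i, if (n i : ℝ) ≤ 16 / η ^ 2 then π i else 0 := by
  rw [← Finset.sum_filter]
  refine le_mul_sum_few_pulls (m := m) h.1 hn hη hη1 fun i hi => ?_
  have h1 := sum_mul_excess_le (m := m) (n := n) h.1.1 S hS
  have h2 := h.marginal_le hi o
  have h3 : 1 / 4 * (4 * η) ≤ (∑ j ∈ S, π j) * excess m n o u :=
    mul_le_mul hmass hu (by positivity) (by linarith)
  simp only [mul_sub, Finset.sum_sub_distrib] at h1 ⊢
  linarith

/-- Applied with `a` proportional to `T` and `b` to `K / η ^ 3`: the exponent `1/3` undoes the cube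
and yields the rate `K^(1/3) T^(2/3)`. -/
lemma le_rpow_mul_rpow {x a b : ℝ} (hx : 0 ≤ x) (ha : x ≤ a) (hb : x ≤ b) :
    x ≤ a ^ (2 / 3 : ℝ) * b ^ (1 / 3 : ℝ) := by
  have h1 : x = x ^ (2 / 3 : ℝ) * x ^ (1 / 3 : ℝ) := by
    rw [← Real.rpow_add' hx (by norm_num)]
    norm_num
  calc x = x ^ (2 / 3 : ℝ) * x ^ (1 / 3 : ℝ) := h1
    _ ≤ _ := mul_le_mul (Real.rpow_le_rpow hx ha (by norm_num))
      (Real.rpow_le_rpow hx hb (by norm_num)) (Real.rpow_nonneg hx _)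
      (Real.rpow_nonneg (hx.trans ha) _)

/-! ### Rounds in which arm `0` is neglected at a fixed sample -/

section Run

variable {Ω : Type*} {K : ℕ} [NeZero K] [MeasurableSpace Ω] {P : Measure Ω}
  {μ : Fin K → ℝ} {X : Fin K → ℕ → Ω → ℝ} {I : ℕ → Ω → Fin K}

/-- The conditional probability of pulling a suboptimal arm that is not overestimated. -/
noncomputable def soundMass (P : Measure Ω) (μ : Fin K → ℝ) (X : Fin K → ℕ → Ω → ℝ)
    (I : ℕ → Ω → Fin K) (ε : ℝ) (t : ℕ) (ω : Ω) : ℝ :=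
  ∑ i ∈ (Finset.univ.erase 0).filter (fun i => empMean X I i t ω ≤ μ i + ε), policy P X I t i ω

lemma measurable_soundMass (ε : ℝ) (t : ℕ) :
    Measurable[past X I t] (soundMass P μ X I ε t) := by
  have : soundMass P μ X I ε t = fun ω => ∑ i ∈ Finset.univ.erase 0,
      if empMean X I i t ω ≤ μ i + ε then policy P X I t i ω else 0 := by
    ext ω
    rw [soundMass, Finset.sum_filter]
  rw [this]
  let _ := past X I t
  refine Finset.measurable_fun_sum _ fun i _ => Measurable.ite ?_ ?_ measurable_const
  · exact measurableSet_le (measurable_past_empMean X I t i) measurable_const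
  · exact stronglyMeasurable_condExp.measurable

/-- The event that arm `0` has been pulled `k` times, that its rewards lie in `E`, and that the
suboptimal arms that are not overestimated are likely to be pulled. -/
def stuck (P : Measure Ω) (μ : Fin K → ℝ) (X : Fin K → ℕ → Ω → ℝ) (I : ℕ → Ω → Fin K) (ε : ℝ)
    (k : ℕ) (E : Set Ω) (t : ℕ) : Set Ω :=
  {ω | pulls I 0 t ω = k} ∩ E ∩ {ω | 1 / 4 ≤ soundMass P μ X I ε t ω}

lemma measurableSet_stuck (ε : ℝ) (k : ℕ) {E : Set Ω} {t : ℕ} (hE : MeasurableSet[past X I t] E) :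
    MeasurableSet[past X I t] (stuck P μ X I ε k E t) := by
  refine MeasurableSet.inter (MeasurableSet.inter ?_ hE) ?_
  · exact measurable_past_pulls X I t 0 (measurableSet_singleton k)
  · exact measurable_soundMass ε t measurableSet_Ici

namespace IsRun

variable [IsProbabilityMeasure P]

lemma sum_stuck_le_card_mul (ε : ℝ) (k : ℕ) (E : Set Ω) (T : ℕ) :
    ∑ t ∈ Finset.Ico K T, P.real (stuck P μ X I ε k E t) ≤ T * P.real E := by
  calc _ ≤ ∑ t ∈ Finset.Ico K T, P.real E :=
        Finset.sum_le_sum fun t _ => measureReal_mono fun ω hω => hω.1.2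
    _ = ((T - K : ℕ) : ℝ) * P.real E := by simp
    _ ≤ _ := by
        refine mul_le_mul_of_nonneg_right ?_ measureReal_nonneg
        exact_mod_cast Nat.sub_le _ _

/-- While arm `0` keeps its sample and is not pulled although its potential is at least `4 η`, arms
with few pulls are pulled. -/
lemma sum_stuck_le (h : IsRun P 2 μ X I) {ε : ℝ} (hgap : ∀ i, i ≠ 0 → μ i + ε ≤ μ 0 - 4 * ε)
    {k : ℕ} {E : Set Ω} (hE : ∀ t, MeasurableSet[past X I t] E) {η : ℝ} (hη : 0 < η) (hη1 : η ≤ 1)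
    (hpot : ∀ ω ∈ E, 4 * η ≤ surplus (avg X 0 k ω) ((k : ℝ≥0)⁻¹) (μ 0 - 4 * ε)) (T : ℕ) :
    ∑ t ∈ Finset.Ico K T, P.real (stuck P μ X I ε k E t) ≤
      K * (16 * logFactor η / η ^ 3) * P.real E := by
  have hE0 : MeasurableSet E := h.past_le 0 _ (hE 0)
  set S : ℕ → Set Ω := fun l => if (l : ℝ) ≤ 16 / η ^ 2 then E else ∅ with hS
  have hSt : ∀ t l, MeasurableSet[past X I t] (S l) := by
    intro t l
    simp only [hS]
    split_ifs
    · exact hE t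
    · exact @MeasurableSet.empty _ (past X I t)
  have hS0 : ∀ l, MeasurableSet (S l) := fun l => h.past_le 0 _ (hSt 0 l)
  set H : ℕ → Fin K → Ω → ℝ := fun t i ω =>
    (S (pulls I i t ω)).indicator (fun _ => (1 : ℝ)) ω with hH
  have hHm : ∀ t i, Measurable[past X I t] (H t i) := by
    intro t i
    let _ := past X I t
    exact measurable_past_comp_pulls i (f := fun l => (S l).indicator fun _ => (1 : ℝ))
      fun l => measurable_const.indicator (hSt t l)
  have hHb : ∀ t i ω, |H t i ω| ≤ 1 := by
    intro t i ω
    simp only [hH, Set.indicator]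
    split_ifs <;> simp
  have hLF := logFactor_pos hη hη1
  -- In a stuck round the conditional probability of pulling some arm with at most `16 / η ^ 2`
  -- pulls is at least `η / logFactor η`.
  have hround : ∀ t ∈ Finset.Ico K T, P.real (stuck P μ X I ε k E t) ≤
      logFactor η / η * ∑ i, ∫ ω, H t i ω * hit I t i ω ∂P := by
    intro t ht
    have htK := (Finset.mem_Ico.1 ht).1
    have hmeas : MeasurableSet (stuck P μ X I ε k E t) :=
      h.past_le t _ (measurableSet_stuck ε k (hE t))
    have hi : ∀ i, Integrable (fun ω => H t i ω * policy P X I t i ω) P := fun i =>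
      h.integrable_bdd_mul_policy t i (hHm t i) (hHb t i)
    have e1 : P.real (stuck P μ X I ε k E t) =
        ∫ ω, (stuck P μ X I ε k E t).indicator (fun _ => (1 : ℝ)) ω ∂P := by
      rw [integral_indicator hmeas]; simp
    have e2 : logFactor η / η * ∑ i, ∫ ω, H t i ω * hit I t i ω ∂P =
        ∫ ω, logFactor η / η * ∑ i, H t i ω * policy P X I t i ω ∂P := by
      rw [integral_const_mul, integral_finsetSum _ fun i _ => hi i]
      congr 1
      exact Finset.sum_congr rfl fun i _ => (h.integral_mul_policy t i (hHm t i) (hHb t i)).symm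
    rw [e1, e2]
    refine integral_mono_ae ((integrable_const _).indicator hmeas)
      ((integrable_finsetSum _ fun i _ => hi i).const_mul _) ?_
    filter_upwards [h.ae_isOptimal, h.ae_one_le_pulls] with ω hopt hpulls
    have hopt := hopt t htK
    have hp0 : ∀ i, 0 ≤ policy P X I t i ω := hopt.1.1
    by_cases hω : ω ∈ stuck P μ X I ε k E t
    · obtain ⟨⟨hk, hωE⟩, hmass⟩ := hω
      rw [Set.indicator_of_mem (by exact ⟨⟨hk, hωE⟩, hmass⟩)]
      have hk' : pulls I 0 t ω = k := hk
      have h1 := hopt.le_logFactor_mul (fun i => hpulls i t htK) (o := 0) (u := μ 0 - 4 * ε)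
        ((Finset.univ.erase 0).filter fun i => empMean X I i t ω ≤ μ i + ε)
        (fun j hj => by
          rw [Finset.mem_filter, Finset.mem_erase] at hj
          exact ⟨hj.1.1, hj.2.trans (hgap j hj.1.1)⟩) hmass hη hη1
        (by
          rw [excess_eq, empMean_eq, hk']
          exact hpot ω hωE)
      have h2 : ∀ i, H t i ω * policy P X I t i ω =
          if (pulls I i t ω : ℝ) ≤ 16 / η ^ 2 then policy P X I t i ω else 0 := by
        intro i
        simp only [hH, hS]
        split_ifs <;> simp [hωE]
      simp only [h2]
      rw [div_mul_eq_mul_div, le_div_iff₀ hη, one_mul]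
      exact h1
    · rw [Set.indicator_of_notMem hω]
      refine mul_nonneg (by positivity) (Finset.sum_nonneg fun i _ => mul_nonneg ?_ (hp0 i))
      exact Set.indicator_nonneg (fun _ _ => zero_le_one) _
  -- Each arm has at most `16 / η ^ 2` such pulls. Since `E` is the same event in all rounds, its
  -- probability factors out.
  have hcount : ∀ i, ∑ t ∈ Finset.Ico K T, ∫ ω, H t i ω * hit I t i ω ∂P ≤
      16 / η ^ 2 * P.real E := by
    intro i
    refine (h.sum_integral_indicator_le i hS0 T).trans ?_
    have h1 : ∀ l, P.real (S l) = if (l : ℝ) ≤ 16 / η ^ 2 then P.real E else 0 := by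
      intro l
      simp only [hS]
      split_ifs <;> simp
    simp only [h1]
    rw [← Finset.sum_filter, Finset.sum_const, nsmul_eq_mul]
    exact mul_le_mul_of_nonneg_right (card_Ico_filter_le (by positivity) T) measureReal_nonneg
  calc _ ≤ ∑ t ∈ Finset.Ico K T, logFactor η / η * ∑ i, ∫ ω, H t i ω * hit I t i ω ∂P :=
        Finset.sum_le_sum hround
    _ = logFactor η / η * ∑ i, ∑ t ∈ Finset.Ico K T, ∫ ω, H t i ω * hit I t i ω ∂P := by
        rw [← Finset.mul_sum, Finset.sum_comm]
    _ ≤ logFactor η / η * ∑ i : Fin K, 16 / η ^ 2 * P.real E := by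
        refine mul_le_mul_of_nonneg_left (Finset.sum_le_sum fun i _ => hcount i) (by positivity)
    _ = _ := by
        simp only [Finset.sum_const, Finset.card_univ, Fintype.card_fin, nsmul_eq_mul]
        field_simp

end IsRun

end Run

/-! ### Deviation levels of arm `0` -/

/-- A lower bound for the potential of arm `0` after `k` pulls at deviation level `l`. -/
noncomputable def levelValue (k l : ℕ) : ℝ :=
  Real.exp (-6) * Real.exp (-l) / (24 * √(k : ℝ) * (l + 1))

lemma levelValue_pos {k : ℕ} (hk : 1 ≤ k) (l : ℕ) : 0 < levelValue k l := by
  have : (0 : ℝ) < k := by positivity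
  unfold levelValue
  positivity

lemma levelValue_le_one {k : ℕ} (hk : 1 ≤ k) (l : ℕ) : levelValue k l ≤ 1 := by
  have h0 : (1 : ℝ) ≤ k := by exact_mod_cast hk
  have h1 : 1 ≤ √(k : ℝ) := Real.one_le_sqrt.2 h0
  have h2 : Real.exp (-6) ≤ 1 := Real.exp_le_one_iff.2 (by norm_num)
  have h3 : Real.exp (-(l : ℝ)) ≤ 1 := Real.exp_le_one_iff.2 (by simp)
  have h4 : (0 : ℝ) ≤ l := by positivity
  rw [levelValue, div_le_one (by positivity)]
  have h5 : Real.exp (-6) * Real.exp (-(l : ℝ)) ≤ 1 := mul_le_one₀ h2 (Real.exp_pos _).le h3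
  nlinarith

lemma inv_levelValue {k : ℕ} (hk : 1 ≤ k) (l : ℕ) :
    1 / levelValue k l = 24 * Real.exp 6 * (√(k : ℝ) * (l + 1) * Real.exp l) := by
  have : (0 : ℝ) < k := by positivity
  have hs : 0 < √(k : ℝ) := Real.sqrt_pos.2 this
  rw [levelValue, Real.exp_neg, Real.exp_neg]
  field_simp

/-- For levels up to `log T` and samples up to `T`, `1 / levelValue k l` is at most a constant times
`T ^ 3`. -/
lemma logFactor_levelValue_le {k l T : ℕ} (hk : 1 ≤ k) (hkT : k ≤ T) (hl : (l : ℝ) ≤ Real.log T) :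
    logFactor (levelValue k l) ≤ 180 * (1 + Real.log T) := by
  have hT : (0 : ℝ) < T := by exact_mod_cast (by omega : 0 < T)
  have h0 : (1 : ℝ) ≤ k := by exact_mod_cast hk
  have h1 : √(k : ℝ) ≤ T := by
    refine Real.sqrt_le_iff.2 ⟨hT.le, ?_⟩
    have : (k : ℝ) ≤ T := by exact_mod_cast hkT
    nlinarith
  have h2 : (l : ℝ) + 1 ≤ T := by
    refine (Real.add_one_le_exp _).trans ?_
    rw [← Real.exp_log hT]; exact Real.exp_le_exp.2 hl
  have h3 : Real.exp l ≤ T := by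
    rw [← Real.exp_log hT]; exact Real.exp_le_exp.2 hl
  have h4 : (96 : ℝ) ≤ Real.exp 5 := by
    have h := Real.exp_one_gt_d9
    have e : Real.exp 5 = Real.exp 1 ^ 5 := by rw [← Real.exp_nat_mul]; norm_num
    rw [e]
    calc (96 : ℝ) ≤ 2.7 ^ 5 := by norm_num
      _ ≤ _ := by gcongr; linarith
  have h5 : 4 / levelValue k l ≤ Real.exp (11 + 3 * Real.log T) := by
    have e1 : 4 / levelValue k l = 4 * (1 / levelValue k l) := by ring
    have e2 : Real.exp (11 + 3 * Real.log T) = Real.exp 5 * Real.exp 6 * (T * T * T) := by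
      have : Real.log T + Real.log T + Real.log T = 3 * Real.log T := by ring
      rw [Real.exp_add, ← this, Real.exp_add, Real.exp_add, Real.exp_log hT, ← Real.exp_add]
      norm_num
    rw [e1, inv_levelValue hk, e2]
    calc 4 * (24 * Real.exp 6 * (√(k : ℝ) * (l + 1) * Real.exp l))
        = 96 * Real.exp 6 * (√(k : ℝ) * (l + 1) * Real.exp l) := by ring
      _ ≤ _ := by gcongr
  have h6 : Real.log (4 / levelValue k l) ≤ 11 + 3 * Real.log T := by
    rw [← Real.log_exp (11 + 3 * Real.log T)]
    exact Real.log_le_log (div_pos (by norm_num) (levelValue_pos hk l)) h5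
  have h7 : 0 ≤ Real.log T := le_trans (by positivity) hl
  unfold logFactor
  linarith

lemma rpow_logFactor_le {K k l T : ℕ} (hk : 1 ≤ k) (hkT : k ≤ T) (hl : (l : ℝ) ≤ Real.log T) :
    (K * (16 * logFactor (levelValue k l) / levelValue k l ^ 3)) ^ (1 / 3 : ℝ) ≤
      (K : ℝ) ^ (1 / 3 : ℝ) * (360 * Real.exp 6 * (1 + Real.log T) ^ 2 * √(k : ℝ) * Real.exp l) := by
  have hη := levelValue_pos hk l
  have hη1 := levelValue_le_one hk l
  have hlog : 0 ≤ Real.log T := le_trans (by positivity) hl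
  -- `15 ^ 3` exceeds `16 * 180`. The logarithm is raised to its cube so that `z` is an exact cube
  -- root.
  set z : ℝ := 15 * (1 + Real.log T) * (1 / levelValue k l) with hz
  have hz0 : 0 ≤ z := by positivity
  have h1 : (K : ℝ) * (16 * logFactor (levelValue k l) / levelValue k l ^ 3) ≤ K * z ^ 3 := by
    refine mul_le_mul_of_nonneg_left ?_ (by positivity)
    have e : z ^ 3 = (15 * (1 + Real.log T)) ^ 3 / levelValue k l ^ 3 := by
      rw [hz]; field_simp
    rw [e]
    refine div_le_div_of_nonneg_right ?_ (by positivity)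
    have := logFactor_levelValue_le hk hkT hl
    have h2 : 1 + Real.log T ≤ (1 + Real.log T) ^ 3 := le_self_pow₀ (by linarith) (by norm_num)
    nlinarith
  have hLF := logFactor_pos hη hη1
  calc _ ≤ (K * z ^ 3) ^ (1 / 3 : ℝ) := Real.rpow_le_rpow (by positivity) h1 (by norm_num)
    _ = (K : ℝ) ^ (1 / 3 : ℝ) * z := by
        rw [Real.mul_rpow (by positivity) (by positivity), ← Real.rpow_natCast z 3,
          ← Real.rpow_mul hz0]
        norm_num
    _ ≤ _ := by
        refine mul_le_mul_of_nonneg_left ?_ (by positivity)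
        rw [hz, inv_levelValue hk]
        have : (l : ℝ) + 1 ≤ 1 + Real.log T := by linarith
        calc 15 * (1 + Real.log T) * (24 * Real.exp 6 * (√(k : ℝ) * (l + 1) * Real.exp l))
            ≤ 15 * (1 + Real.log T) *
              (24 * Real.exp 6 * (√(k : ℝ) * (1 + Real.log T) * Real.exp l)) := by gcongr
          _ = _ := by ring

section Run

variable {Ω : Type*} {K : ℕ} [NeZero K] {μ : Fin K → ℝ} {X : Fin K → ℕ → Ω → ℝ}
  {I : ℕ → Ω → Fin K}

/-- The event that the mean of the first `k` rewards of arm `0` is low, at deviation level at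
least `l`. -/
def lowMean (μ : Fin K → ℝ) (X : Fin K → ℕ → Ω → ℝ) (ε : ℝ) (k l : ℕ) : Set Ω :=
  {ω | avg X 0 k ω < μ 0 - ε / 2} ∩
    {ω | (l : ℝ) ≤ k * (max (μ 0 - avg X 0 k ω - 4 * ε) 0) ^ 2 / 2}

lemma mem_lowMean_zero {ε : ℝ} {k : ℕ} {ω : Ω} (h : avg X 0 k ω < μ 0 - ε / 2) :
    ω ∈ lowMean μ X ε k 0 := by
  refine ⟨h, ?_⟩
  change ((0 : ℕ) : ℝ) ≤ _
  rw [Nat.cast_zero]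
  positivity

lemma measurableSet_lowMean (ε : ℝ) (k l t : ℕ) :
    MeasurableSet[past X I t] (lowMean μ X ε k l) := by
  have h := measurable_past_avg X I t 0 k
  let _ := past X I t
  refine MeasurableSet.inter (measurableSet_lt h measurable_const)
    (measurableSet_le measurable_const ?_)
  fun_prop

/-- On this slice the normalized distance `y` to the level satisfies `y ^ 2 / 2 < l + 1`. Hence `exp
(-(y ^ 2 / 2))` costs `exp (-1) * exp (-l)` and `(1 + y) ^ 2 ≤ 6 * (l + 1)`; inserted in
`le_surplus`, these give the constants `exp (-6)` and `24 = 4 * 6` of `levelValue`. -/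
lemma levelValue_le_surplus {ε : ℝ} {k l : ℕ} (hk : 1 ≤ k) {ω : Ω}
    (hω : ω ∈ lowMean μ X ε k l \ lowMean μ X ε k (l + 1)) :
    4 * levelValue k l ≤ surplus (avg X 0 k ω) ((k : ℝ≥0)⁻¹) (μ 0 - 4 * ε) := by
  have hk0 : (0 : ℝ) < k := by positivity
  have hs : 0 < √(k : ℝ) := Real.sqrt_pos.2 hk0
  have hs2 : √(k : ℝ) ^ 2 = k := Real.sq_sqrt hk0.le
  set d := max (μ 0 - avg X 0 k ω - 4 * ε) 0 with hd
  have hd0 : 0 ≤ d := le_max_right _ _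
  have hlt : k * d ^ 2 / 2 < (l : ℝ) + 1 := by
    by_contra hge
    refine hω.2 ⟨hω.1.1, ?_⟩
    change ((l + 1 : ℕ) : ℝ) ≤ k * d ^ 2 / 2
    push_cast
    linarith
  have hv : √(((k : ℝ≥0)⁻¹ : ℝ≥0) : ℝ) = (√(k : ℝ))⁻¹ := by
    rw [NNReal.coe_inv, NNReal.coe_natCast, Real.sqrt_inv]
  have hle := le_surplus (m := avg X 0 k ω) (u := μ 0 - 4 * ε) (y := √(k : ℝ) * d)
    (v := (k : ℝ≥0)⁻¹) (inv_ne_zero (by positivity)) (by positivity) (by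
      rw [hv, inv_mul_cancel_left₀ hs.ne']
      linarith [le_max_left (μ 0 - avg X 0 k ω - 4 * ε) 0])
  refine le_trans ?_ hle
  set y := √(k : ℝ) * d with hy
  have hy2 : y ^ 2 = k * d ^ 2 := by rw [hy, mul_pow, hs2]
  have hy0 : 0 ≤ y := by positivity
  rw [hv]
  have h1 : Real.exp (-1) * Real.exp (-l) ≤ Real.exp (-(y ^ 2 / 2)) := by
    rw [← Real.exp_add]
    refine Real.exp_le_exp.2 ?_
    rw [hy2]; linarith
  have h2 : (1 + y) ^ 2 ≤ 6 * (l + 1) := by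
    have : (0 : ℝ) ≤ l := by positivity
    nlinarith [sq_nonneg (1 - y)]
  have e : 4 * levelValue k l =
      (√(k : ℝ))⁻¹ * (Real.exp (-5) * (Real.exp (-1) * Real.exp (-l)) / (6 * (l + 1))) := by
    have : Real.exp (-6) = Real.exp (-5) * Real.exp (-1) := by rw [← Real.exp_add]; norm_num
    rw [levelValue, this]
    field_simp
    norm_num
  rw [e]
  gcongr

variable [MeasurableSpace Ω] {P : Measure Ω} [IsProbabilityMeasure P]

namespace IsRun

/-- At level `0` the deviation `ε / 2` alone gives the bound. At level `l ≥ 1` the deviation is at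
least `4 * ε + √(2 * l / k)`, and dropping the cross term of its square leaves both exponents. -/
lemma measureReal_lowMean_le {M : ℕ} (h : IsRun P M μ X I) {ε : ℝ} (hε : 0 < ε) {k : ℕ}
    (hk : 1 ≤ k) (l : ℕ) :
    P.real (lowMean μ X ε k l) ≤ Real.exp (-l) * Real.exp (-(k * (ε ^ 2 / 8))) := by
  have hk0 : (0 : ℝ) < k := by positivity
  rw [← Real.exp_add]
  rcases Nat.eq_zero_or_pos l with hl | hl
  · subst hl
    calc P.real (lowMean μ X ε k 0) ≤ P.real {ω | avg X 0 k ω ≤ μ 0 - ε / 2} :=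
          measureReal_mono fun ω hω => by
            have h1 : avg X 0 k ω < μ 0 - ε / 2 := hω.1
            exact h1.le
      _ ≤ _ := h.avg_lower_tail 0 hk (by positivity)
      _ ≤ _ := Real.exp_le_exp.2 (le_of_eq (by push_cast; ring))
  · have hl0 : (0 : ℝ) < l := by exact_mod_cast hl
    set s := √(2 * l / k) with hs
    have hs2 : s ^ 2 = 2 * l / k := Real.sq_sqrt (by positivity)
    have hs0 : 0 < s := Real.sqrt_pos.2 (by positivity)
    calc P.real (lowMean μ X ε k l) ≤ P.real {ω | avg X 0 k ω ≤ μ 0 - (4 * ε + s)} := by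
          refine measureReal_mono fun ω hω => ?_
          have h1 : (l : ℝ) ≤ k * (max (μ 0 - avg X 0 k ω - 4 * ε) 0) ^ 2 / 2 := hω.2
          have h2 : s ≤ max (μ 0 - avg X 0 k ω - 4 * ε) 0 := by
            refine Real.sqrt_le_iff.2 ⟨le_max_right _ _, ?_⟩
            rw [div_le_iff₀ hk0]; linarith
          change avg X 0 k ω ≤ μ 0 - (4 * ε + s)
          rcases le_max_iff.1 h2 with h3 | h3 <;> linarith
      _ ≤ _ := h.avg_lower_tail 0 hk (by positivity)
      _ ≤ _ := by
          refine Real.exp_le_exp.2 ?_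
          have e : (k : ℝ) * (4 * ε + s) ^ 2 / 2 = k * (8 * ε ^ 2) + 4 * k * ε * s + k * s ^ 2 / 2 := by
            ring
          have e2 : (k : ℝ) * s ^ 2 / 2 = l := by rw [hs2]; field_simp
          rw [e, e2]
          have : 0 ≤ 4 * k * ε * s := by positivity
          nlinarith [mul_pos hk0 (pow_pos hε 2)]

/-- Expected number of rounds at one sample size and one deviation level in which arm `0` is
neglected. -/
lemma sum_stuck_level_le (h : IsRun P 2 μ X I) {ε : ℝ} (hε : 0 < ε)
    (hgap : ∀ i, i ≠ 0 → μ i + ε ≤ μ 0 - 4 * ε) {k l T : ℕ} (hk : 1 ≤ k) (hkT : k ≤ T)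
    (hl : (l : ℝ) ≤ Real.log T) :
    ∑ t ∈ Finset.Ico K T,
        P.real (stuck P μ X I ε k (lowMean μ X ε k l \ lowMean μ X ε k (l + 1)) t) ≤
      360 * Real.exp 6 * (1 + Real.log T) ^ 2 * ((K : ℝ) ^ (1 / 3 : ℝ) * (T : ℝ) ^ (2 / 3 : ℝ)) *
        (√(k : ℝ) * Real.exp (-(k * (ε ^ 2 / 8)))) := by
  set E := lowMean μ X ε k l \ lowMean μ X ε k (l + 1) with hE
  have hEm : ∀ t, MeasurableSet[past X I t] E := fun t =>
    @MeasurableSet.diff _ (past X I t) _ _ (measurableSet_lowMean ε k l t)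
      (measurableSet_lowMean ε k (l + 1) t)
  have hη := levelValue_pos hk l
  have hη1 := levelValue_le_one hk l
  have hLF := logFactor_pos hη hη1
  have h1 := h.sum_stuck_le hgap hEm hη hη1 (fun ω hω => levelValue_le_surplus hk hω) T
  have h2 := sum_stuck_le_card_mul (P := P) (μ := μ) (X := X) (I := I) ε k E T
  have h3 : 0 ≤ ∑ t ∈ Finset.Ico K T, P.real (stuck P μ X I ε k E t) :=
    Finset.sum_nonneg fun t _ => measureReal_nonneg
  have h4 := le_rpow_mul_rpow h3 h2 h1
  set p := P.real E with hp
  have hp0 : 0 ≤ p := measureReal_nonneg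
  have hpp : p ^ (2 / 3 : ℝ) * p ^ (1 / 3 : ℝ) = p := by
    rw [← Real.rpow_add' hp0 (by norm_num)]; norm_num
  have hp1 : p ≤ Real.exp (-l) * Real.exp (-(k * (ε ^ 2 / 8))) :=
    (measureReal_mono Set.sdiff_subset).trans (h.measureReal_lowMean_le hε hk l)
  have hlog : 0 ≤ Real.log T := le_trans (by positivity) hl
  rw [Real.mul_rpow (by positivity) hp0, Real.mul_rpow (by positivity) hp0] at h4
  calc _ ≤ _ := h4
    -- The two powers of `p` recombine to `p`, whose factor `exp (-l)` cancels the `exp l` coming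
    -- from `1 / levelValue k l`.
    _ = (T : ℝ) ^ (2 / 3 : ℝ) *
        (K * (16 * logFactor (levelValue k l) / levelValue k l ^ 3)) ^ (1 / 3 : ℝ) *
        (p ^ (2 / 3 : ℝ) * p ^ (1 / 3 : ℝ)) := by ring
    _ ≤ (T : ℝ) ^ (2 / 3 : ℝ) * ((K : ℝ) ^ (1 / 3 : ℝ) *
        (360 * Real.exp 6 * (1 + Real.log T) ^ 2 * √(k : ℝ) * Real.exp l)) *
        (Real.exp (-l) * Real.exp (-(k * (ε ^ 2 / 8)))) := by
        rw [hpp]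
        have := rpow_logFactor_le (K := K) hk hkT hl
        gcongr
    _ = 360 * Real.exp 6 * (1 + Real.log T) ^ 2 * ((K : ℝ) ^ (1 / 3 : ℝ) * (T : ℝ) ^ (2 / 3 : ℝ)) *
        (√(k : ℝ) * Real.exp (-(k * (ε ^ 2 / 8)))) * (Real.exp l * Real.exp (-l)) := by ring
    _ = _ := by
        rw [← Real.exp_add, add_neg_cancel, Real.exp_zero, mul_one]

/-- The event is sliced by the sample size of arm `0` and its deviation level. The levels from `L`
on stay together, because there the trivial bound suffices. -/
lemma neglected_subset (h : IsRun P 2 μ X I) (ε : ℝ) (L : ℕ) {t T : ℕ} (htK : K ≤ t) (htT : t < T) :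
    P.real ({ω | empMean X I 0 t ω < μ 0 - ε / 2} ∩ {ω | 1 / 4 ≤ soundMass P μ X I ε t ω}) ≤
      ∑ k ∈ Finset.Ico 1 T, (∑ l ∈ Finset.range L,
        P.real (stuck P μ X I ε k (lowMean μ X ε k l \ lowMean μ X ε k (l + 1)) t) +
        P.real (stuck P μ X I ε k (lowMean μ X ε k L) t)) := by
  set B := ⋃ k ∈ Finset.Ico 1 T, ((⋃ l ∈ Finset.range L,
      stuck P μ X I ε k (lowMean μ X ε k l \ lowMean μ X ε k (l + 1)) t) ∪
      stuck P μ X I ε k (lowMean μ X ε k L) t) with hB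
  have hsub : ({ω | empMean X I 0 t ω < μ 0 - ε / 2} ∩
      {ω | 1 / 4 ≤ soundMass P μ X I ε t ω} : Set Ω) ≤ᵐ[P] B := by
    filter_upwards [h.ae_one_le_pulls] with ω hω hmem
    obtain ⟨h1, h2⟩ := hmem
    have h1' : avg X 0 (pulls I 0 t ω) ω < μ 0 - ε / 2 := by
      rw [← empMean_eq]; exact h1
    set k := pulls I 0 t ω with hk
    refine Set.mem_biUnion (x := k)
      (by exact Finset.mem_Ico.2 ⟨hω 0 t htK, (pulls_le I 0 t ω).trans_lt htT⟩) ?_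
    by_cases hL : ω ∈ lowMean μ X ε k L
    · exact Or.inr ⟨⟨rfl, hL⟩, h2⟩
    · left
      have hex : ∃ l, ω ∉ lowMean μ X ε k (l + 1) := by
        rcases L with _ | L
        · exact absurd (mem_lowMean_zero h1') hL
        · exact ⟨L, hL⟩
      classical
      have hmin := Nat.find_spec hex
      set l := Nat.find hex with hl
      have hmem : ω ∈ lowMean μ X ε k l := by
        rcases hl0 : l with _ | l'
        · exact mem_lowMean_zero h1'
        · by_contra hn
          have : l ≤ l' := Nat.find_le hn
          omega
      have hlL : l < L := by
        by_contra hge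
        rcases L with _ | L
        · exact hL (mem_lowMean_zero h1')
        · have : l ≤ L := Nat.find_le hL
          omega
      exact Set.mem_biUnion (by exact Finset.mem_range.2 hlL) ⟨⟨rfl, hmem, hmin⟩, h2⟩
  calc _ ≤ P.real B := ENNReal.toReal_mono (measure_ne_top _ _) (measure_mono_ae hsub)
    _ ≤ _ := by
      refine (measureReal_biUnion_finset_le _ _).trans (Finset.sum_le_sum fun k _ => ?_)
      refine (measureReal_union_le _ _).trans ?_
      gcongr
      exact measureReal_biUnion_finset_le _ _

/-- Expected number of rounds in which arm `0` is underestimated although the suboptimal arms that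
are not overestimated are likely to be pulled. -/
lemma sum_neglected_le (h : IsRun P 2 μ X I) {ε : ℝ} (hε : 0 < ε)
    (hgap : ∀ i, i ≠ 0 → μ i + ε ≤ μ 0 - 4 * ε) {T : ℕ} (hT : 1 ≤ T) :
    ∑ t ∈ Finset.Ico K T, P.real ({ω | empMean X I 0 t ω < μ 0 - ε / 2} ∩
        {ω | 1 / 4 ≤ soundMass P μ X I ε t ω}) ≤
      48 * (360 * Real.exp 6) * (1 + Real.log T) ^ 3 *
        ((K : ℝ) ^ (1 / 3 : ℝ) * (T : ℝ) ^ (2 / 3 : ℝ) / ε ^ 3) + 8 / ε ^ 2 := by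
  have hT0 : (0 : ℝ) < T := by exact_mod_cast hT
  have hlogT : 0 ≤ Real.log T := Real.log_nonneg (by exact_mod_cast hT)
  -- At this level `T * exp (-L) ≤ 1`, so all deeper deviations cost a bounded number of rounds per
  -- sample size, with decay in `k`.
  set L := ⌈Real.log T⌉₊ with hL
  set a := ε ^ 2 / 8 with ha
  have ha0 : 0 < a := by positivity
  set c := 360 * Real.exp 6 * (1 + Real.log T) ^ 2 *
    ((K : ℝ) ^ (1 / 3 : ℝ) * (T : ℝ) ^ (2 / 3 : ℝ)) with hc
  have hc0 : 0 ≤ c := by positivity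
  have hLle : (L : ℝ) ≤ 1 + Real.log T := by
    have := (Nat.ceil_lt_add_one hlogT).le
    linarith
  have h1 : ∀ k ∈ Finset.Ico 1 T, ∀ l ∈ Finset.range L, ∑ t ∈ Finset.Ico K T,
      P.real (stuck P μ X I ε k (lowMean μ X ε k l \ lowMean μ X ε k (l + 1)) t) ≤
      c * (√(k : ℝ) * Real.exp (-(k * a))) := by
    intro k hk l hl
    rw [Finset.mem_Ico] at hk
    refine h.sum_stuck_level_le hε hgap hk.1 hk.2.le ?_
    exact (Nat.lt_ceil.1 (Finset.mem_range.1 hl)).le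
  have h2 : ∀ k ∈ Finset.Ico 1 T, ∑ t ∈ Finset.Ico K T,
      P.real (stuck P μ X I ε k (lowMean μ X ε k L) t) ≤ Real.exp (-(k * a)) := by
    intro k hk
    rw [Finset.mem_Ico] at hk
    refine (sum_stuck_le_card_mul ε k _ T).trans ?_
    have h3 := h.measureReal_lowMean_le hε hk.1 L
    have h4 : (T : ℝ) * Real.exp (-L) ≤ 1 := by
      rw [Real.exp_neg, mul_inv_le_iff₀ (Real.exp_pos _), one_mul]
      calc (T : ℝ) = Real.exp (Real.log T) := (Real.exp_log hT0).symm
        _ ≤ _ := Real.exp_le_exp.2 (Nat.le_ceil _)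
    calc (T : ℝ) * P.real (lowMean μ X ε k L)
        ≤ T * (Real.exp (-L) * Real.exp (-(k * a))) := by gcongr
      _ = (T * Real.exp (-L)) * Real.exp (-(k * a)) := by ring
      _ ≤ 1 * Real.exp (-(k * a)) := by gcongr
      _ = _ := one_mul _
  -- From `√(1/8) ≥ 1/3`, with `48 = 2 * 8 * 3`.
  have hsqrt : 2 / (a * √a) ≤ 48 / ε ^ 3 := by
    have h5 : ε / 3 ≤ √a := by
      refine Real.le_sqrt_of_sq_le ?_
      rw [ha]; nlinarith [sq_nonneg ε]
    have h6 : a * (ε / 3) ≤ a * √a := by gcongr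
    calc 2 / (a * √a) ≤ 2 / (a * (ε / 3)) := by gcongr
      _ = _ := by rw [ha]; field_simp; norm_num
  calc _ ≤ ∑ t ∈ Finset.Ico K T, ∑ k ∈ Finset.Ico 1 T, (∑ l ∈ Finset.range L,
        P.real (stuck P μ X I ε k (lowMean μ X ε k l \ lowMean μ X ε k (l + 1)) t) +
        P.real (stuck P μ X I ε k (lowMean μ X ε k L) t)) :=
        Finset.sum_le_sum fun t ht =>
          h.neglected_subset ε L (Finset.mem_Ico.1 ht).1 (Finset.mem_Ico.1 ht).2
    _ = ∑ k ∈ Finset.Ico 1 T, (∑ l ∈ Finset.range L, ∑ t ∈ Finset.Ico K T,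
        P.real (stuck P μ X I ε k (lowMean μ X ε k l \ lowMean μ X ε k (l + 1)) t) +
        ∑ t ∈ Finset.Ico K T, P.real (stuck P μ X I ε k (lowMean μ X ε k L) t)) := by
        rw [Finset.sum_comm]
        refine Finset.sum_congr rfl fun k _ => ?_
        rw [Finset.sum_add_distrib, Finset.sum_comm]
    _ ≤ ∑ k ∈ Finset.Ico 1 T, (∑ l ∈ Finset.range L, c * (√(k : ℝ) * Real.exp (-(k * a))) +
        Real.exp (-(k * a))) :=
        Finset.sum_le_sum fun k hk => add_le_add (Finset.sum_le_sum (h1 k hk)) (h2 k hk)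
    _ = L * c * ∑ k ∈ Finset.Ico 1 T, √(k : ℝ) * Real.exp (-(k * a)) +
        ∑ k ∈ Finset.Ico 1 T, Real.exp (-(k * a)) := by
        rw [Finset.sum_add_distrib, Finset.mul_sum]
        congr 1
        refine Finset.sum_congr rfl fun k _ => ?_
        rw [Finset.sum_const, Finset.card_range, nsmul_eq_mul]
        ring
    _ ≤ (1 + Real.log T) * c * (48 / ε ^ 3) + 8 / ε ^ 2 := by
        refine add_le_add ?_ ((sum_exp_neg_le ha0 T).trans_eq (by rw [ha]; field_simp))
        refine mul_le_mul (by gcongr) ((sum_sqrt_mul_exp_neg_le ha0 T).trans hsqrt) ?_ (by positivity)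
        exact Finset.sum_nonneg fun k _ => by positivity
    _ = _ := by rw [hc]; ring

end IsRun

end Run

/-! ### The four causes of regret in one round -/

section Run

variable {Ω : Type*} {K : ℕ} {μ : Fin K → ℝ} {X : Fin K → ℕ → Ω → ℝ}
  {I : ℕ → Ω → Fin K}

lemma sum_hit (I : ℕ → Ω → Fin K) (t : ℕ) (ω : Ω) : ∑ i, hit I t i ω = 1 := by
  simp [hit_eq]

/-- The event that the mean of the first `k` rewards of arm `i` is too high. -/
def highMean (μ : Fin K → ℝ) (X : Fin K → ℕ → Ω → ℝ) (ε : ℝ) (i : Fin K) (k : ℕ) : Set Ω :=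
  {ω | μ i + ε < avg X i k ω}

lemma measurableSet_highMean (ε : ℝ) (i : Fin K) (k t : ℕ) :
    MeasurableSet[past X I t] (highMean μ X ε i k) := by
  have h := measurable_past_avg X I t i k
  exact h measurableSet_Ioi

lemma measurableSet_highMean_pulls (ε : ℝ) (i : Fin K) (t : ℕ) :
    MeasurableSet[past X I t] {ω | ω ∈ highMean μ X ε i (pulls I i t ω)} := by
  have : {ω | ω ∈ highMean μ X ε i (pulls I i t ω)} = {ω | μ i + ε < empMean X I i t ω} := by
    ext ω
    change μ i + ε < avg X i (pulls I i t ω) ω ↔ μ i + ε < empMean X I i t ω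
    rw [empMean_eq]
  rw [this]
  exact measurable_past_empMean X I t i measurableSet_Ioi

lemma IsRun.integrable_indicator_mul_hit [MeasurableSpace Ω] {P : Measure Ω}
    [IsProbabilityMeasure P] (h : IsRun P 2 μ X I) (t : ℕ) (i : Fin K) {S : Set Ω}
    (hS : MeasurableSet S) :
    Integrable (fun ω => S.indicator (fun _ => (1 : ℝ)) ω * hit I t i ω) P :=
  (h.integrable_hit t i).bdd_mul (c := 1) (measurable_const.indicator hS).aestronglyMeasurable
    (ae_of_all _ fun ω => by by_cases hω : ω ∈ S <;> simp [hω])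

lemma IsRun.integral_indicator_mul_policy [MeasurableSpace Ω] {P : Measure Ω}
    [IsProbabilityMeasure P] (h : IsRun P 2 μ X I) (t : ℕ) (i : Fin K) {S : Set Ω}
    (hS : MeasurableSet[past X I t] S) :
    Integrable (fun ω => S.indicator (fun _ => (1 : ℝ)) ω * policy P X I t i ω) P ∧
    ∫ ω, S.indicator (fun _ => (1 : ℝ)) ω * policy P X I t i ω ∂P =
      ∫ ω, S.indicator (fun _ => (1 : ℝ)) ω * hit I t i ω ∂P := by
  have hm : Measurable[past X I t] (S.indicator fun _ => (1 : ℝ)) := by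
    let _ := past X I t
    exact measurable_const.indicator hS
  have hb : ∀ ω, |S.indicator (fun _ => (1 : ℝ)) ω| ≤ 1 := fun ω => by
    by_cases hω : ω ∈ S <;> simp [hω]
  exact ⟨h.integrable_bdd_mul_policy t i hm hb, h.integral_mul_policy t i hm hb⟩

variable [NeZero K]

lemma gap_eq_sum_hit (μ : Fin K → ℝ) (I : ℕ → Ω → Fin K) (t : ℕ) (ω : Ω) :
    μ 0 - μ (I t ω) = ∑ i ∈ Finset.univ.erase 0, gap μ i * hit I t i ω := by
  rw [Finset.sum_erase Finset.univ (by simp [gap])]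
  simp [hit_eq, gap]

/-- The event that arm `0` is underestimated in round `t`. -/
def underrated (μ : Fin K → ℝ) (X : Fin K → ℕ → Ω → ℝ) (I : ℕ → Ω → Fin K) (ε : ℝ) (t : ℕ) :
    Set Ω :=
  {ω | empMean X I 0 t ω < μ 0 - ε / 2}

/-- The event that the estimates of arm `0` and of arm `i` are accurate and that arm `i` has been
pulled more than `r` times. -/
def explored (μ : Fin K → ℝ) (X : Fin K → ℕ → Ω → ℝ) (I : ℕ → Ω → Fin K) (ε r : ℝ) (i : Fin K)
    (t : ℕ) : Set Ω :=
  {ω | μ 0 - ε / 2 ≤ empMean X I 0 t ω} ∩ {ω | empMean X I i t ω ≤ μ i + ε} ∩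
    {ω | r < (pulls I i t ω : ℝ)}


lemma measurableSet_underrated (ε : ℝ) (t : ℕ) :
    MeasurableSet[past X I t] (underrated μ X I ε t) :=
  measurable_past_empMean X I t 0 measurableSet_Iio

lemma measurableSet_explored (ε r : ℝ) (i : Fin K) (t : ℕ) :
    MeasurableSet[past X I t] (explored μ X I ε r i t) := by
  refine MeasurableSet.inter (MeasurableSet.inter ?_ ?_) ?_
  · exact measurable_past_empMean X I t 0 measurableSet_Ici
  · exact measurable_past_empMean X I t i measurableSet_Iic
  · have hr : MeasurableSet {k : ℕ | r < k} := .of_discrete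
    exact measurable_past_pulls X I t i hr

variable [MeasurableSpace Ω] {P : Measure Ω} [IsProbabilityMeasure P]

namespace IsRun

/-- An explored arm is rarely pulled. -/
lemma integral_explored_le (h : IsRun P 2 μ X I) {ε : ℝ} (hε : 0 < ε) {i : Fin K} (hi : i ≠ 0)
    (hgap : 5 * ε ≤ gap μ i) {r : ℝ} {T t : ℕ} (hT : 1 ≤ T) (htK : K ≤ t)
    (hr : Real.log T ≤ r * (18 / 100 * gap μ i ^ 2)) :
    ∫ ω, (explored μ X I ε r i t).indicator (fun _ => (1 : ℝ)) ω * hit I t i ω ∂P ≤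
      2 / gap μ i * (1 / T + ∫ ω, Real.exp (-(pulls I 0 t ω * (ε ^ 2 / 8))) * hit I t 0 ω ∂P) := by
  have hΔ : 0 < gap μ i := by linarith
  have hT0 : (0 : ℝ) < T := by exact_mod_cast hT
  obtain ⟨hi1, hi2⟩ := h.integral_indicator_mul_policy t i (measurableSet_explored (μ := μ) ε r i t)
  have hm : Measurable[past X I t] fun ω => Real.exp (-(pulls I 0 t ω * (ε ^ 2 / 8))) :=
    measurable_past_comp_pulls (0 : Fin K)
      (f := fun (k : ℕ) (_ : Ω) => Real.exp (-((k : ℝ) * (ε ^ 2 / 8)))) fun k => measurable_const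
  have hb : ∀ ω, |Real.exp (-(pulls I 0 t ω * (ε ^ 2 / 8)))| ≤ 1 := fun ω => by
    rw [abs_of_pos (Real.exp_pos _)]
    refine Real.exp_le_one_iff.2 ?_
    have : (0 : ℝ) ≤ pulls I 0 t ω * (ε ^ 2 / 8) := by positivity
    linarith
  have hj1 := h.integrable_bdd_mul_policy t 0 hm hb
  -- Optimality is used for conditional probabilities. The factor `π 0` in `mul_sub_le` then turns
  -- back into pulls of arm `0`, over which the exponential weights are summable.
  rw [← hi2, ← h.integral_mul_policy t 0 hm hb]
  calc ∫ ω, (explored μ X I ε r i t).indicator (fun _ => (1 : ℝ)) ω * policy P X I t i ω ∂P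
      ≤ ∫ ω, 2 / gap μ i * (1 / T + Real.exp (-(pulls I 0 t ω * (ε ^ 2 / 8))) *
          policy P X I t 0 ω) ∂P := by
        refine integral_mono_ae hi1 (((integrable_const _).add hj1).const_mul _) ?_
        filter_upwards [h.ae_isOptimal, h.ae_one_le_pulls] with ω hopt hpulls
        have hopt := hopt t htK
        have hp0 : ∀ i, 0 ≤ policy P X I t i ω := hopt.1.1
        by_cases hω : ω ∈ explored μ X I ε r i t
        · rw [Set.indicator_of_mem hω, one_mul]
          obtain ⟨⟨h0, h1⟩, h2⟩ := hω
          change μ 0 - ε / 2 ≤ empMean X I 0 t ω at h0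
          change empMean X I i t ω ≤ μ i + ε at h1
          change r < (pulls I i t ω : ℝ) at h2
          have hg : gap μ i = μ 0 - μ i := rfl
          -- The level `μ 0 - ε` lies at least `ε / 2` below the estimate of arm `0` and at least
          -- `gap μ i - 2 * ε ≥ 6/10 * gap μ i` above that of arm `i`; hence `18/100 = (6/10) ^ 2 /
          -- 2`.
          have key := hopt.mul_sub_le (o := 0) hi (u := μ 0 - ε) (by linarith)
          have e1 := excess_le (m := fun i => empMean X I i t ω) (n := fun i => pulls I i t ω)
            (i := i) (u := μ 0 - ε) (hpulls i t htK) (by linarith)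
          have e2 := deficit_le (m := fun i => empMean X I i t ω) (n := fun i => pulls I i t ω)
            (i := 0) (u := μ 0 - ε) (hpulls 0 t htK) (by linarith)
          have e3 : √((pulls I i t ω : ℝ)⁻¹) *
              Real.exp (-(pulls I i t ω * (μ 0 - ε - empMean X I i t ω) ^ 2 / 2)) ≤ 1 / T := by
            calc _ ≤ 1 * Real.exp (-Real.log T) := by
                  refine mul_le_mul (sqrt_inv_le_one (hpulls i t htK)) (Real.exp_le_exp.2 ?_)
                    (Real.exp_pos _).le zero_le_one
                  have h3 : (6 / 10 * gap μ i) ^ 2 ≤ (μ 0 - ε - empMean X I i t ω) ^ 2 := by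
                    refine pow_le_pow_left₀ (by positivity) ?_ 2
                    linarith
                  have h4 : r * (18 / 100 * gap μ i ^ 2) ≤
                      pulls I i t ω * (18 / 100 * gap μ i ^ 2) := by gcongr
                  have h5 : (pulls I i t ω : ℝ) * (6 / 10 * gap μ i) ^ 2 ≤
                      pulls I i t ω * (μ 0 - ε - empMean X I i t ω) ^ 2 := by gcongr
                  linarith
              _ = 1 / T := by rw [one_mul, Real.exp_neg, Real.exp_log hT0, one_div]
          have e4 : √((pulls I 0 t ω : ℝ)⁻¹) *
              Real.exp (-(pulls I 0 t ω * (empMean X I 0 t ω - (μ 0 - ε)) ^ 2 / 2)) ≤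
              Real.exp (-(pulls I 0 t ω * (ε ^ 2 / 8))) := by
            calc _ ≤ 1 * Real.exp (-(pulls I 0 t ω * (ε ^ 2 / 8))) := by
                  refine mul_le_mul (sqrt_inv_le_one (hpulls 0 t htK)) (Real.exp_le_exp.2 ?_)
                    (Real.exp_pos _).le zero_le_one
                  have h3 : (ε / 2) ^ 2 ≤ (empMean X I 0 t ω - (μ 0 - ε)) ^ 2 := by
                    refine pow_le_pow_left₀ (by positivity) ?_ 2
                    linarith
                  have h5 : (pulls I 0 t ω : ℝ) * (ε / 2) ^ 2 ≤
                      pulls I 0 t ω * (empMean X I 0 t ω - (μ 0 - ε)) ^ 2 := by gcongr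
                  linarith
              _ = _ := one_mul _
          have e5 := mul_le_mul_of_nonneg_left (e2.trans e4) (hp0 0)
          have e6 : policy P X I t i ω * (gap μ i / 2) ≤
              policy P X I t i ω * (empMean X I 0 t ω - empMean X I i t ω) :=
            mul_le_mul_of_nonneg_left (by linarith) (hp0 i)
          have e7 : policy P X I t i ω * (gap μ i / 2) ≤ 1 / T +
              Real.exp (-(pulls I 0 t ω * (ε ^ 2 / 8))) * policy P X I t 0 ω := by
            have := e1.trans e3
            linarith
          calc policy P X I t i ω = 2 / gap μ i * (policy P X I t i ω * (gap μ i / 2)) := by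
                field_simp
            _ ≤ _ := mul_le_mul_of_nonneg_left e7 (by positivity)
        · rw [Set.indicator_of_notMem hω, zero_mul]
          have := hp0 0
          positivity
    _ = _ := by
        rw [integral_const_mul, integral_add (integrable_const _) hj1]
        simp

/-- The probability that arm `0` is underestimated. -/
lemma measureReal_underrated_le (h : IsRun P 2 μ X I) (ε : ℝ) {t : ℕ} (htK : K ≤ t) :
    P.real (underrated μ X I ε t) ≤
      2 * ∑ i ∈ Finset.univ.erase 0,
        ∫ ω, (highMean μ X ε i (pulls I i t ω)).indicator (fun _ => (1 : ℝ)) ω * hit I t i ω ∂P +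
      4 * ∫ ω, (underrated μ X I ε t).indicator (fun _ => (1 : ℝ)) ω * hit I t 0 ω ∂P +
      P.real (underrated μ X I ε t ∩ {ω | 1 / 4 ≤ soundMass P μ X I ε t ω}) := by
  have hB := measurableSet_underrated (μ := μ) (X := X) (I := I) ε t
  have hB0 := h.past_le t _ hB
  have hQ : MeasurableSet {ω | 1 / 4 ≤ soundMass P μ X I ε t ω} :=
    h.past_le t _ (measurable_soundMass ε t measurableSet_Ici)
  have hO : ∀ i, ∀ ω, (highMean μ X ε i (pulls I i t ω)).indicator (fun _ => (1 : ℝ)) ω =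
      {ω | ω ∈ highMean μ X ε i (pulls I i t ω)}.indicator (fun _ => (1 : ℝ)) ω := by
    intro i ω
    by_cases hω : ω ∈ highMean μ X ε i (pulls I i t ω) <;> simp [hω]
  have hOi := fun i => h.integral_indicator_mul_policy t i
    (measurableSet_highMean_pulls (μ := μ) (X := X) (I := I) ε i t)
  obtain ⟨hb1, hb2⟩ := h.integral_indicator_mul_policy t 0 hB
  simp only [hO]
  simp only [← fun i => (hOi i).2]
  rw [← hb2]
  have e1 : P.real (underrated μ X I ε t) =
      ∫ ω, (underrated μ X I ε t).indicator (fun _ => (1 : ℝ)) ω ∂P := by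
    rw [integral_indicator hB0]; simp
  have e2 : P.real (underrated μ X I ε t ∩ {ω | 1 / 4 ≤ soundMass P μ X I ε t ω}) =
      ∫ ω, (underrated μ X I ε t ∩ {ω | 1 / 4 ≤ soundMass P μ X I ε t ω}).indicator
        (fun _ => (1 : ℝ)) ω ∂P := by
    rw [integral_indicator (hB0.inter hQ)]; simp
  rw [e1, e2, ← integral_finsetSum _ fun i _ => (hOi i).1, ← integral_const_mul,
    ← integral_const_mul]
  have hs1 := ((integrable_finsetSum (Finset.univ.erase 0) fun i _ => (hOi i).1).const_mul (2 : ℝ))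
  have hs3 : Integrable ((underrated μ X I ε t ∩ {ω | 1 / 4 ≤ soundMass P μ X I ε t ω}).indicator
        (fun _ => (1 : ℝ))) P := (integrable_const _).indicator (hB0.inter hQ)
  rw [← integral_add_add hs1 (hb1.const_mul 4) hs3]
  refine integral_mono_ae ((integrable_const _).indicator hB0)
    ((hs1.add (hb1.const_mul 4)).add hs3) ?_
  filter_upwards [h.ae_isOptimal] with ω hopt
  have hopt := hopt t htK
  have hp0 : ∀ i, 0 ≤ policy P X I t i ω := hopt.1.1
  have hp1 : ∑ i, policy P X I t i ω = 1 := hopt.1.2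
  have hover : ∑ i ∈ Finset.univ.erase 0, {ω | ω ∈ highMean μ X ε i (pulls I i t ω)}.indicator
      (fun _ => (1 : ℝ)) ω * policy P X I t i ω =
      ∑ i ∈ (Finset.univ.erase 0).filter (fun i => ¬ empMean X I i t ω ≤ μ i + ε),
        policy P X I t i ω := by
    rw [Finset.sum_filter]
    refine Finset.sum_congr rfl fun i _ => ?_
    rw [← hO]
    by_cases hω : ω ∈ highMean μ X ε i (pulls I i t ω)
    · have : ¬ empMean X I i t ω ≤ μ i + ε := by rw [empMean_eq]; exact not_le.2 hω
      rw [Set.indicator_of_mem hω, if_pos this, one_mul]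
    · have : empMean X I i t ω ≤ μ i + ε := by rw [empMean_eq]; exact not_lt.1 hω
      rw [Set.indicator_of_notMem hω, if_neg (not_not.2 this), zero_mul]
  have hsplit := Finset.sum_filter_add_sum_filter_not (Finset.univ.erase (0 : Fin K))
    (fun i => empMean X I i t ω ≤ μ i + ε) (fun i => policy P X I t i ω)
  have hall := Finset.add_sum_erase Finset.univ (fun i => policy P X I t i ω)
    (Finset.mem_univ (0 : Fin K))
  simp only [hover]
  have hnn : 0 ≤ ∑ i ∈ (Finset.univ.erase 0).filter (fun i => ¬ empMean X I i t ω ≤ μ i + ε),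
        policy P X I t i ω := Finset.sum_nonneg fun i _ => hp0 i
  have hp00 := hp0 0
  by_cases hω : ω ∈ underrated μ X I ε t
  · rw [Set.indicator_of_mem hω]
    -- If the sound mass is below `1/4`, overestimated arms and arm `0` share more than `3/4`, so
    -- the weights `2` and `4` more than suffice.
    by_cases hq : 1 / 4 ≤ soundMass P μ X I ε t ω
    · rw [Set.indicator_of_mem (by exact ⟨hω, hq⟩)]
      linarith
    · rw [Set.indicator_of_notMem fun hh => hq hh.2]
      rw [soundMass] at hq
      linarith
  · rw [Set.indicator_of_notMem hω, Set.indicator_of_notMem fun hh => hω hh.1]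
    linarith

end IsRun

end Run

/-! ### Summation over rounds -/

section Run

variable {Ω : Type*} {K : ℕ} [NeZero K] {μ : Fin K → ℝ} {X : Fin K → ℕ → Ω → ℝ}
  {I : ℕ → Ω → Fin K} [MeasurableSpace Ω] {P : Measure Ω} [IsProbabilityMeasure P]

namespace IsRun

lemma integrable_gap_arm (h : IsRun P 2 μ X I) (t : ℕ) :
    Integrable (fun ω => μ 0 - μ (I t ω)) P := by
  simp only [gap_eq_sum_hit]
  exact integrable_finsetSum _ fun i _ => (h.integrable_hit t i).const_mul _

/-- One round of the regret decomposition. -/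
lemma integral_gap_arm_le (h : IsRun P 2 μ X I) {d : ℝ} (hgap0 : ∀ i, i ≠ 0 → 0 ≤ gap μ i)
    (hd : ∀ i, i ≠ 0 → gap μ i ≤ d) (hd0 : 0 ≤ d) (ε : ℝ) (r : Fin K → ℝ) (t : ℕ) :
    ∫ ω, (μ 0 - μ (I t ω)) ∂P ≤ ∑ i ∈ Finset.univ.erase 0, gap μ i *
      (∫ ω, (highMean μ X ε i (pulls I i t ω)).indicator (fun _ => (1 : ℝ)) ω * hit I t i ω ∂P +
       ∫ ω, (if (pulls I i t ω : ℝ) ≤ r i then 1 else 0) * hit I t i ω ∂P +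
       ∫ ω, (explored μ X I ε (r i) i t).indicator (fun _ => (1 : ℝ)) ω * hit I t i ω ∂P) +
      d * P.real (underrated μ X I ε t) := by
  have hB0 : MeasurableSet (underrated μ X I ε t) := h.past_le t _ (measurableSet_underrated ε t)
  have h1 : ∀ i, Integrable (fun ω =>
      (highMean μ X ε i (pulls I i t ω)).indicator (fun _ => (1 : ℝ)) ω * hit I t i ω) P := by
    intro i
    refine (h.integrable_indicator_mul_hit t i
      (h.past_le t _ (measurableSet_highMean_pulls (μ := μ) ε i t))).congr (ae_of_all _ fun ω => ?_)
    by_cases hω : ω ∈ highMean μ X ε i (pulls I i t ω) <;> simp [hω]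
  have h2 : ∀ i, Integrable (fun ω =>
      (if (pulls I i t ω : ℝ) ≤ r i then (1 : ℝ) else 0) * hit I t i ω) P := by
    intro i
    refine (h.integrable_hit t i).bdd_mul (c := 1) ?_ (ae_of_all _ fun ω => ?_)
    · exact (h.measurable_comp_pulls t i (f := fun (k : ℕ) (_ : Ω) => if (k : ℝ) ≤ r i then (1 : ℝ)
        else 0) fun k => measurable_const).aestronglyMeasurable
    · split_ifs <;> simp
  have h3 : ∀ i, Integrable (fun ω =>
      (explored μ X I ε (r i) i t).indicator (fun _ => (1 : ℝ)) ω * hit I t i ω) P := fun i =>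
    h.integrable_indicator_mul_hit t i (h.past_le t _ (measurableSet_explored ε (r i) i t))
  have h4 : Integrable ((underrated μ X I ε t).indicator fun _ => (1 : ℝ)) P :=
    (integrable_const _).indicator hB0
  have e1 : P.real (underrated μ X I ε t) =
      ∫ ω, (underrated μ X I ε t).indicator (fun _ => (1 : ℝ)) ω ∂P := by
    rw [integral_indicator hB0]; simp
  rw [e1, ← integral_const_mul]
  simp only [← fun i => integral_add_add (h1 i) (h2 i) (h3 i), ← integral_const_mul]
  have h5 : ∀ i, Integrable (fun ω => gap μ i *
      ((highMean μ X ε i (pulls I i t ω)).indicator (fun _ => (1 : ℝ)) ω * hit I t i ω +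
        (if (pulls I i t ω : ℝ) ≤ r i then 1 else 0) * hit I t i ω +
        (explored μ X I ε (r i) i t).indicator (fun _ => (1 : ℝ)) ω * hit I t i ω)) P :=
    fun i => (((h1 i).add (h2 i)).add (h3 i)).const_mul (gap μ i)
  rw [← integral_finsetSum _ fun i _ => h5 i, ← integral_add
    (integrable_finsetSum _ fun i _ => h5 i) (h4.const_mul d)]
  refine integral_mono (h.integrable_gap_arm t)
    ((integrable_finsetSum _ fun i _ => h5 i).add (h4.const_mul d)) fun ω => ?_
  simp only
  rw [gap_eq_sum_hit]
  -- An underrated round is charged the full `d`; in any other round each suboptimal arm falls under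
  -- at least one of its three indicators.
  by_cases hω : ω ∈ underrated μ X I ε t
  · rw [Set.indicator_of_mem hω, mul_one]
    have h6 : ∑ i ∈ Finset.univ.erase 0, gap μ i * hit I t i ω ≤ d := by
      calc _ ≤ ∑ i ∈ Finset.univ.erase 0, d * hit I t i ω :=
            Finset.sum_le_sum fun i hi => mul_le_mul_of_nonneg_right
              (hd i (Finset.ne_of_mem_erase hi)) (hit_nonneg I t i ω)
        _ ≤ ∑ i, d * hit I t i ω := Finset.sum_le_univ_sum_of_nonneg fun i =>
            mul_nonneg hd0 (hit_nonneg I t i ω)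
        _ = d := by rw [← Finset.mul_sum, sum_hit, mul_one]
    refine h6.trans (le_add_of_nonneg_left (Finset.sum_nonneg fun i hi => ?_))
    refine mul_nonneg (hgap0 i (Finset.ne_of_mem_erase hi)) ?_
    have h7 := hit_nonneg I t i ω
    refine add_nonneg (add_nonneg (mul_nonneg ?_ h7) (mul_nonneg ?_ h7)) (mul_nonneg ?_ h7)
    · exact Set.indicator_nonneg (fun _ _ => zero_le_one) _
    · split_ifs <;> norm_num
    · exact Set.indicator_nonneg (fun _ _ => zero_le_one) _
  · rw [Set.indicator_of_notMem hω, mul_zero, add_zero]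
    refine Finset.sum_le_sum fun i hi => mul_le_mul_of_nonneg_left ?_
      (hgap0 i (Finset.ne_of_mem_erase hi))
    rw [← add_mul, ← add_mul]
    refine le_mul_of_one_le_left (hit_nonneg I t i ω) ?_
    have hn1 : 0 ≤ (highMean μ X ε i (pulls I i t ω)).indicator (fun _ => (1 : ℝ)) ω :=
      Set.indicator_nonneg (fun _ _ => zero_le_one) _
    have hn2 : (0 : ℝ) ≤ if (pulls I i t ω : ℝ) ≤ r i then 1 else 0 := by split_ifs <;> norm_num
    have hn3 : 0 ≤ (explored μ X I ε (r i) i t).indicator (fun _ => (1 : ℝ)) ω :=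
      Set.indicator_nonneg (fun _ _ => zero_le_one) _
    by_cases c1 : ω ∈ highMean μ X ε i (pulls I i t ω)
    · rw [Set.indicator_of_mem c1] at hn1 ⊢
      linarith
    · by_cases c2 : (pulls I i t ω : ℝ) ≤ r i
      · rw [if_pos c2] at hn2 ⊢
        linarith
      · have c3 : ω ∈ explored μ X I ε (r i) i t := by
          refine ⟨⟨?_, ?_⟩, not_le.1 c2⟩
          · change μ 0 - ε / 2 ≤ empMean X I 0 t ω
            exact not_lt.1 hω
          · change empMean X I i t ω ≤ μ i + ε
            rw [empMean_eq]; exact not_lt.1 c1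
        rw [Set.indicator_of_mem c3] at hn3 ⊢
        linarith

lemma integral_regret_eq (h : IsRun P 2 μ X I) (T : ℕ) :
    ∫ ω, regret μ I T ω ∂P = ∑ t ∈ Finset.range T, ∫ ω, (μ 0 - μ (I t ω)) ∂P := by
  unfold regret
  rw [integral_finsetSum _ fun t _ => h.integrable_gap_arm t]

lemma integral_gap_arm_le_max (h : IsRun P 2 μ X I) {d : ℝ} (hd : ∀ i, gap μ i ≤ d) (t : ℕ) :
    ∫ ω, (μ 0 - μ (I t ω)) ∂P ≤ d := by
  calc _ ≤ ∫ _, d ∂P :=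
        integral_mono (h.integrable_gap_arm t) (integrable_const _) fun ω => hd (I t ω)
    _ = d := by simp

/-- The regret bound with all terms explicit. -/
lemma integral_regret_le (h : IsRun P 2 μ X I) {ε d : ℝ} (hε : 0 < ε)
    (hgap : ∀ i, i ≠ 0 → 5 * ε ≤ gap μ i) (hd : ∀ i, i ≠ 0 → gap μ i ≤ d) (hd0 : 0 ≤ d)
    {T : ℕ} (hT : 1 ≤ T) :
    ∫ ω, regret μ I T ω ∂P ≤
      ∑ i ∈ Finset.univ.erase 0, 6 * (Real.log T / gap μ i) +
      d * (K + 6 * (K / ε ^ 2) + 40 / ε ^ 2 + 48 * (360 * Real.exp 6) * (1 + Real.log T) ^ 3 *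
        ((K : ℝ) ^ (1 / 3 : ℝ) * (T : ℝ) ^ (2 / 3 : ℝ) / ε ^ 3)) + (2 * K + 16 * (K / ε ^ 2)) := by
  have hT0 : (0 : ℝ) < T := by exact_mod_cast hT
  have hlogT : 0 ≤ Real.log T := Real.log_nonneg (by exact_mod_cast hT)
  have hgap0 : ∀ i, i ≠ 0 → 0 < gap μ i := fun i hi => by linarith [hgap i hi]
  have hg0 : gap μ 0 = 0 := sub_self _
  have hgap0' : ∀ i, 0 ≤ gap μ i := fun i => by
    by_cases hi : i = 0
    · rw [hi, hg0]
    · exact (hgap0 i hi).le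
  have hd' : ∀ i, gap μ i ≤ d := fun i => by
    by_cases hi : i = 0
    · rw [hi, hg0]; exact hd0
    · exact hd i hi
  -- The smallest threshold that `integral_explored_le` admits; `gap μ i * r i` is `100/18 ≤ 6`
  -- times `log T / gap μ i`.
  set r : Fin K → ℝ := fun i => Real.log T / (18 / 100 * gap μ i ^ 2) with hr
  have hr0 : ∀ i, 0 ≤ r i := fun i => by simp only [hr]; positivity
  set main := 48 * (360 * Real.exp 6) * (1 + Real.log T) ^ 3 *
    ((K : ℝ) ^ (1 / 3 : ℝ) * (T : ℝ) ^ (2 / 3 : ℝ) / ε ^ 3) with hmain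
  -- overestimated arms
  have hO : ∀ i, ∑ t ∈ Finset.Ico K T,
      ∫ ω, (highMean μ X ε i (pulls I i t ω)).indicator (fun _ => (1 : ℝ)) ω * hit I t i ω ∂P ≤
      2 / ε ^ 2 := by
    intro i
    refine (h.sum_integral_indicator_le i (S := highMean μ X ε i)
      (fun k => h.past_le 0 _ (measurableSet_highMean ε i k 0)) T).trans ?_
    calc _ ≤ ∑ k ∈ Finset.Ico 1 T, Real.exp (-(k * (ε ^ 2 / 2))) := by
          refine Finset.sum_le_sum fun k hk => ?_
          refine (measureReal_mono fun ω hω => ?_).trans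
            ((h.avg_upper_tail i (Finset.mem_Ico.1 hk).1 hε.le).trans_eq (by ring_nf))
          have h1 : μ i + ε < avg X i k ω := hω
          exact h1.le
      _ ≤ 1 / (ε ^ 2 / 2) := sum_exp_neg_le (by positivity) T
      _ = _ := by field_simp
  -- arms with few pulls
  have hW : ∀ i, ∑ t ∈ Finset.Ico K T,
      ∫ ω, (if (pulls I i t ω : ℝ) ≤ r i then 1 else 0) * hit I t i ω ∂P ≤ r i := by
    intro i
    refine (h.sum_integral_comp_pulls_le i (f := fun (k : ℕ) (_ : Ω) =>
      if (k : ℝ) ≤ r i then (1 : ℝ) else 0) (c := 1) (fun k => measurable_const)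
      (fun k ω => ?_) (fun k ω => ?_) T).trans ?_
    · split_ifs <;> norm_num
    · split_ifs <;> norm_num
    · simp only [integral_const, probReal_univ, one_smul]
      rw [Finset.sum_boole]
      exact card_Ico_filter_le (hr0 i) T
  -- pulls of arm `0` with a posterior far below its mean
  have hA : ∑ t ∈ Finset.Ico K T,
      ∫ ω, Real.exp (-(pulls I 0 t ω * (ε ^ 2 / 8))) * hit I t 0 ω ∂P ≤ 8 / ε ^ 2 := by
    refine (h.sum_integral_comp_pulls_le 0 (f := fun (k : ℕ) (_ : Ω) =>
      Real.exp (-(k * (ε ^ 2 / 8)))) (c := 1) (fun k => measurable_const)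
      (fun k ω => (Real.exp_pos _).le) (fun k ω => ?_) T).trans ?_
    · refine Real.exp_le_one_iff.2 ?_
      have : (0 : ℝ) ≤ k * (ε ^ 2 / 8) := by positivity
      linarith
    · simp only [integral_const, probReal_univ, one_smul]
      exact (sum_exp_neg_le (by positivity) T).trans_eq (by field_simp)
  -- pulls of arm `0` while it is underestimated
  have hU : ∑ t ∈ Finset.Ico K T,
      ∫ ω, (underrated μ X I ε t).indicator (fun _ => (1 : ℝ)) ω * hit I t 0 ω ∂P ≤ 8 / ε ^ 2 := by
    have e : ∀ t ω, (underrated μ X I ε t).indicator (fun _ => (1 : ℝ)) ω =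
        (lowMean μ X ε (pulls I 0 t ω) 0).indicator (fun _ => (1 : ℝ)) ω := by
      intro t ω
      by_cases hω : ω ∈ underrated μ X I ε t
      · have h1 : ω ∈ lowMean μ X ε (pulls I 0 t ω) 0 := by
          refine mem_lowMean_zero ?_
          rw [← empMean_eq]; exact hω
        rw [Set.indicator_of_mem hω, Set.indicator_of_mem h1]
      · have h1 : ω ∉ lowMean μ X ε (pulls I 0 t ω) 0 := by
          intro hh
          refine hω ?_
          change empMean X I 0 t ω < μ 0 - ε / 2
          rw [empMean_eq]; exact hh.1
        rw [Set.indicator_of_notMem hω, Set.indicator_of_notMem h1]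
    simp only [e]
    refine (h.sum_integral_indicator_le 0 (S := fun k => lowMean μ X ε k 0)
      (fun k => h.past_le 0 _ (measurableSet_lowMean ε k 0 0)) T).trans ?_
    calc _ ≤ ∑ k ∈ Finset.Ico 1 T, Real.exp (-(k * (ε ^ 2 / 8))) := by
          refine Finset.sum_le_sum fun k hk => ?_
          refine (h.measureReal_lowMean_le hε (Finset.mem_Ico.1 hk).1 0).trans_eq ?_
          simp
      _ ≤ 1 / (ε ^ 2 / 8) := sum_exp_neg_le (by positivity) T
      _ = _ := by field_simp
  have hN : ∑ t ∈ Finset.Ico K T, P.real (underrated μ X I ε t ∩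
      {ω | 1 / 4 ≤ soundMass P μ X I ε t ω}) ≤ main + 8 / ε ^ 2 :=
    h.sum_neglected_le hε (fun i hi => by
      have h1 := hgap i hi
      have h2 : gap μ i = μ 0 - μ i := rfl
      linarith) hT
  have hcard : ((Finset.univ.erase (0 : Fin K)).card : ℝ) ≤ K := by
    have := Finset.card_le_univ (Finset.univ.erase (0 : Fin K))
    rw [Fintype.card_fin] at this
    exact_mod_cast this
  have hsumc : ∀ (f : Fin K → ℝ) (c : ℝ), 0 ≤ c → (∀ i, i ≠ 0 → f i ≤ c) →
      ∑ i ∈ Finset.univ.erase 0, f i ≤ K * c := by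
    intro f c hc hf
    calc _ ≤ ∑ i ∈ Finset.univ.erase (0 : Fin K), c :=
          Finset.sum_le_sum fun i hi => hf i (Finset.ne_of_mem_erase hi)
      _ = (Finset.univ.erase (0 : Fin K)).card * c := by rw [Finset.sum_const, nsmul_eq_mul]
      _ ≤ K * c := mul_le_mul_of_nonneg_right hcard hc
  have hV : ∑ t ∈ Finset.Ico K T, P.real (underrated μ X I ε t) ≤
      2 * (K * (2 / ε ^ 2)) + 4 * (8 / ε ^ 2) + (main + 8 / ε ^ 2) := by
    calc _ ≤ _ := Finset.sum_le_sum fun t ht =>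
          h.measureReal_underrated_le ε (Finset.mem_Ico.1 ht).1
      _ ≤ _ := by
        rw [Finset.sum_add_distrib, Finset.sum_add_distrib, ← Finset.mul_sum, ← Finset.mul_sum,
          Finset.sum_comm]
        have := hsumc _ (2 / ε ^ 2) (by positivity) fun i _ => hO i
        linarith
  have hE : ∀ i, i ≠ 0 → ∑ t ∈ Finset.Ico K T,
      ∫ ω, (explored μ X I ε (r i) i t).indicator (fun _ => (1 : ℝ)) ω * hit I t i ω ∂P ≤
      2 / gap μ i * (1 + 8 / ε ^ 2) := by
    intro i hi
    have hΔ := hgap0 i hi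
    calc _ ≤ ∑ t ∈ Finset.Ico K T, 2 / gap μ i * (1 / T +
          ∫ ω, Real.exp (-(pulls I 0 t ω * (ε ^ 2 / 8))) * hit I t 0 ω ∂P) := by
          refine Finset.sum_le_sum fun t ht => h.integral_explored_le hε hi (hgap i hi) hT
            (Finset.mem_Ico.1 ht).1 (le_of_eq ?_)
          simp only [hr]
          field_simp
      _ ≤ _ := by
          rw [← Finset.mul_sum, Finset.sum_add_distrib]
          refine mul_le_mul_of_nonneg_left (add_le_add ?_ hA) (by positivity)
          rw [Finset.sum_const, Nat.card_Ico, nsmul_eq_mul, mul_one_div, div_le_one hT0]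
          exact_mod_cast Nat.sub_le _ _
  have hmainSum : ∑ t ∈ Finset.Ico K T, ∫ ω, (μ 0 - μ (I t ω)) ∂P ≤
      ∑ i ∈ Finset.univ.erase 0, gap μ i * (2 / ε ^ 2 + r i + 2 / gap μ i * (1 + 8 / ε ^ 2)) +
      d * (2 * (K * (2 / ε ^ 2)) + 4 * (8 / ε ^ 2) + (main + 8 / ε ^ 2)) := by
    calc _ ≤ _ := Finset.sum_le_sum fun t _ =>
          h.integral_gap_arm_le (fun i hi => (hgap0 i hi).le) hd hd0 ε r t
      _ ≤ _ := by
        rw [Finset.sum_add_distrib, ← Finset.mul_sum, Finset.sum_comm]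
        refine add_le_add (Finset.sum_le_sum fun i hi => ?_) (mul_le_mul_of_nonneg_left hV hd0)
        have hi := Finset.ne_of_mem_erase hi
        rw [← Finset.mul_sum, Finset.sum_add_distrib, Finset.sum_add_distrib]
        exact mul_le_mul_of_nonneg_left (add_le_add (add_le_add (hO i) (hW i)) (hE i hi))
          (hgap0 i hi).le
  have hinit : ∑ t ∈ Finset.range K, ∫ ω, (μ 0 - μ (I t ω)) ∂P ≤ K * d := by
    calc _ ≤ ∑ t ∈ Finset.range K, d :=
          Finset.sum_le_sum fun t _ => h.integral_gap_arm_le_max hd' t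
      _ = _ := by simp
  have hsplit : ∑ i ∈ Finset.univ.erase 0,
      gap μ i * (2 / ε ^ 2 + r i + 2 / gap μ i * (1 + 8 / ε ^ 2)) ≤
      ∑ i ∈ Finset.univ.erase 0, 6 * (Real.log T / gap μ i) +
        K * (d * (2 / ε ^ 2) + 2 * (1 + 8 / ε ^ 2)) := by
    have h1 : ∀ i ∈ Finset.univ.erase (0 : Fin K),
        gap μ i * (2 / ε ^ 2 + r i + 2 / gap μ i * (1 + 8 / ε ^ 2)) ≤
        6 * (Real.log T / gap μ i) + (d * (2 / ε ^ 2) + 2 * (1 + 8 / ε ^ 2)) := by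
      intro i hi
      have hi := Finset.ne_of_mem_erase hi
      have hΔ := hgap0 i hi
      have e1 : gap μ i * r i = 100 / 18 * (Real.log T / gap μ i) := by
        simp only [hr]; field_simp
      -- The gap cancels, so this contribution carries no factor `d`.
      have e2 : gap μ i * (2 / gap μ i * (1 + 8 / ε ^ 2)) = 2 * (1 + 8 / ε ^ 2) := by field_simp
      have e3 : gap μ i * (2 / ε ^ 2) ≤ d * (2 / ε ^ 2) :=
        mul_le_mul_of_nonneg_right (hd i hi) (by positivity)
      have e4 : 0 ≤ Real.log T / gap μ i := by positivity
      rw [mul_add, mul_add, e1, e2]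
      linarith
    refine (Finset.sum_le_sum h1).trans ?_
    rw [Finset.sum_add_distrib]
    exact add_le_add le_rfl (hsumc _ _ (by positivity) fun i _ => le_rfl)
  rw [h.integral_regret_eq]
  -- The union may exceed `range T` when `T < K`; the extra terms are nonnegative.
  calc ∑ t ∈ Finset.range T, ∫ ω, (μ 0 - μ (I t ω)) ∂P
      ≤ ∑ t ∈ Finset.range K ∪ Finset.Ico K T, ∫ ω, (μ 0 - μ (I t ω)) ∂P := by
        refine Finset.sum_le_sum_of_subset_of_nonneg (fun t ht => ?_)
          fun t _ _ => (integral_nonneg fun ω => hgap0' (I t ω))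
        rw [Finset.mem_union, Finset.mem_range, Finset.mem_Ico]
        have := Finset.mem_range.1 ht
        omega
    _ = ∑ t ∈ Finset.range K, ∫ ω, (μ 0 - μ (I t ω)) ∂P +
        ∑ t ∈ Finset.Ico K T, ∫ ω, (μ 0 - μ (I t ω)) ∂P := by
        refine Finset.sum_union (Finset.disjoint_left.2 fun t h1 h2 => ?_)
        have := Finset.mem_range.1 h1
        have := (Finset.mem_Ico.1 h2).1
        omega
    _ ≤ K * d + ((∑ i ∈ Finset.univ.erase 0, 6 * (Real.log T / gap μ i) +
        K * (d * (2 / ε ^ 2) + 2 * (1 + 8 / ε ^ 2))) +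
        d * (2 * (K * (2 / ε ^ 2)) + 4 * (8 / ε ^ 2) + (main + 8 / ε ^ 2))) :=
        add_le_add hinit (hmainSum.trans (add_le_add hsplit le_rfl))
    _ = _ := by ring

end IsRun

end Run

/-! ### Absorption of lower-order terms and sublinearity -/

section Run

variable {Ω : Type*} {K : ℕ} [NeZero K] {μ : Fin K → ℝ} {X : Fin K → ℕ → Ω → ℝ}
  {I : ℕ → Ω → Fin K} [MeasurableSpace Ω] {P : Measure Ω} [IsProbabilityMeasure P]

lemma gap_le_gapMax (μ : Fin K → ℝ) {i : Fin K} (hi : i ≠ 0) : gap μ i ≤ gapMax μ :=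
  le_ciSup (f := fun i : {i : Fin K // i ≠ 0} => gap μ i) (Set.finite_range _).bddAbove ⟨i, hi⟩

lemma gapMin_le_gap (μ : Fin K → ℝ) {i : Fin K} (hi : i ≠ 0) : gapMin μ ≤ gap μ i :=
  ciInf_le (f := fun i : {i : Fin K // i ≠ 0} => gap μ i) (Set.finite_range _).bddBelow ⟨i, hi⟩

lemma exists_ne_zero (hK : 2 ≤ K) : ∃ i : Fin K, i ≠ 0 :=
  ⟨⟨1, hK⟩, fun h => by
    have := congrArg Fin.val h
    simp at this⟩

lemma gapMin_pos (hK : 2 ≤ K) (hμ : ∀ i, i ≠ 0 → μ i < μ 0) : 0 < gapMin μ := by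
  obtain ⟨j, hj⟩ := exists_ne_zero hK
  have : Nonempty {i : Fin K // i ≠ 0} := ⟨⟨j, hj⟩⟩
  obtain ⟨i, hi⟩ := exists_eq_ciInf_of_finite (f := fun i : {i : Fin K // i ≠ 0} => gap μ i)
  unfold gapMin
  rw [← hi]
  exact sub_pos.2 (hμ i i.2)

lemma gapMin_le_gapMax (hK : 2 ≤ K) (μ : Fin K → ℝ) : gapMin μ ≤ gapMax μ := by
  obtain ⟨j, hj⟩ := exists_ne_zero hK
  exact (gapMin_le_gap μ hj).trans (gap_le_gapMax μ hj)

/-- The constant of the regret bounds, for accuracies at most `B`. -/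
noncomputable def boundConst (B : ℝ) : ℝ :=
  6 + 8 * (B ^ 3 + 46 * B + B ^ 2 + 4) +
    48 * (360 * Real.exp 6) * (3 + 2 * Real.log (max B 1)) ^ 3

lemma boundConst_pos {B : ℝ} (hB : 0 < B) : 0 < boundConst B := by
  have : 0 ≤ Real.log (max B 1) := Real.log_nonneg (le_max_right _ _)
  unfold boundConst
  positivity

/-- The bound `ε ≤ B` gives `T ≤ max B 1 * (K * T / ε)`, so `log T` is controlled by the logarithm
in the theorem up to a constant depending on `B`. -/
lemma one_add_log_le {B ε T : ℝ} {K : ℕ} (hB : 0 < B) (hε : 0 < ε) (hεB : ε ≤ B) (hT : 1 ≤ T)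
    (hK : 1 ≤ K) :
    1 / 2 ≤ Real.log (2 + K * T / ε) ∧
      1 + Real.log T ≤ (3 + 2 * Real.log (max B 1)) * Real.log (2 + K * T / ε) := by
  have hK' : (1 : ℝ) ≤ K := by exact_mod_cast hK
  have hx : 0 ≤ K * T / ε := by positivity
  have h1 : 1 / 2 ≤ Real.log (2 + K * T / ε) := by
    have h2 : Real.log 2 ≤ Real.log (2 + K * T / ε) := Real.log_le_log (by norm_num) (by linarith)
    linarith [Real.log_two_gt_d9]
  have hb1 : 1 ≤ max B 1 := le_max_right _ _
  have hb0 : 0 ≤ Real.log (max B 1) := Real.log_nonneg hb1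
  refine ⟨h1, ?_⟩
  have h3 : T ≤ max B 1 * (2 + K * T / ε) := by
    have h4 : T ≤ max B 1 * (K * T / ε) := by
      rw [mul_div_assoc', le_div_iff₀ hε]
      have h5 : ε ≤ max B 1 := hεB.trans (le_max_left _ _)
      have h6 : T ≤ K * T := by nlinarith
      nlinarith
    linarith [mul_add (max B 1) 2 (K * T / ε)]
  have h7 : Real.log T ≤ Real.log (max B 1) + Real.log (2 + K * T / ε) := by
    rw [← Real.log_mul (by positivity) (by positivity)]
    exact Real.log_le_log (by linarith) h3
  linarith [mul_nonneg hb0 (sub_nonneg.2 h1)]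

lemma rpow_third_mul_rpow {x : ℝ} (hx : 0 ≤ x) : x ^ (1 / 3 : ℝ) * x ^ (2 / 3 : ℝ) = x := by
  rw [← Real.rpow_add' hx (by norm_num)]
  norm_num

/-- The regret bound in terms of the divergence. -/
lemma IsRun.integral_regret_le_divergence (h : IsRun P 2 μ X I) (hK : 2 ≤ K) {B : ℝ} (hB : 0 < B)
    {T : ℕ} (hT : 1 ≤ T) {ε : ℝ} (hε : 0 < ε) (hεg : ε ≤ gapMin μ / 5) (hεB : ε ≤ B) :
    ∫ ω, regret μ I T ω ∂P ≤
      ∑ i ∈ Finset.univ.erase (0 : Fin K),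
          boundConst B * (gap μ i * Real.log T / D (μ i + ε) (μ 0 - ε / 2))
        + gapMax μ * (boundConst B * Real.log (2 + K * T / ε) ^ 3 *
          ((K : ℝ) ^ (1 / 3 : ℝ) * (T : ℝ) ^ (2 / 3 : ℝ) / ε ^ 3)) := by
  have hT1 : (1 : ℝ) ≤ T := by exact_mod_cast hT
  have hK1 : (1 : ℝ) ≤ K := by exact_mod_cast (by omega : 1 ≤ K)
  have hlogT : 0 ≤ Real.log T := Real.log_nonneg hT1
  obtain ⟨hΛ, hlogΛ⟩ := one_add_log_le (K := K) hB hε hεB hT1 (by omega)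
  set Λ := Real.log (2 + K * T / ε) with hΛd
  set d := gapMax μ with hdd
  set Y := (K : ℝ) ^ (1 / 3 : ℝ) * (T : ℝ) ^ (2 / 3 : ℝ) with hY
  have hY1 : 1 ≤ Y := by
    have h1 : 1 ≤ (K : ℝ) ^ (1 / 3 : ℝ) := Real.one_le_rpow hK1 (by norm_num)
    have h2 : 1 ≤ (T : ℝ) ^ (2 / 3 : ℝ) := Real.one_le_rpow hT1 (by norm_num)
    nlinarith
  have hgap : ∀ i, i ≠ 0 → 5 * ε ≤ gap μ i := fun i hi => by
    linarith [gapMin_le_gap μ hi]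
  have hd : ∀ i, i ≠ 0 → gap μ i ≤ d := fun i hi => gap_le_gapMax μ hi
  have hd5 : 5 * ε ≤ d := by linarith [gapMin_le_gapMax hK μ]
  have hd0 : 0 ≤ d := by linarith
  have hb0 : 0 ≤ Real.log (max B 1) := Real.log_nonneg (le_max_right _ _)
  set c3 := 48 * (360 * Real.exp 6) * (3 + 2 * Real.log (max B 1)) ^ 3 with hc3
  have hc30 : 0 ≤ c3 := by positivity
  -- In units of `Z`, the terms `K`, `6 K / ε²` with `40 / ε²`, `2 K` and `16 K / ε²` cost `B ^ 3`,
  -- `46 * B`, `B ^ 2` and `4`, the last two after extraction of a factor `d`. The factor `8`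
  -- compensates for `Λ ≥ 1/2`.
  have hC : boundConst B = 6 + 8 * (B ^ 3 + 46 * B + B ^ 2 + 4) + c3 := rfl
  have hC6 : 6 ≤ boundConst B := by
    rw [hC]
    have : 0 ≤ 8 * (B ^ 3 + 46 * B + B ^ 2 + 4) := by positivity
    linarith
  have hΛ3 : 1 ≤ 8 * Λ ^ 3 := by
    have : (1 / 2 : ℝ) ^ 3 ≤ Λ ^ 3 := pow_le_pow_left₀ (by norm_num) hΛ 3
    linarith
  set Z := Y / ε ^ 3 with hZ
  have hZ0 : 0 ≤ Z := by positivity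
  have hYZ : Y ≤ B ^ 3 * Z := by
    have h1 : Y = ε ^ 3 * Z := by rw [hZ]; field_simp
    have h2 : ε ^ 3 ≤ B ^ 3 := pow_le_pow_left₀ hε.le hεB 3
    calc Y = ε ^ 3 * Z := h1
      _ ≤ _ := by gcongr
  have hYZ2 : Y / ε ^ 2 ≤ B * Z := by
    have h1 : Y / ε ^ 2 = ε * Z := by rw [hZ]; field_simp
    rw [h1]; gcongr
  have hfirst : ∑ i ∈ Finset.univ.erase (0 : Fin K), 6 * (Real.log T / gap μ i) ≤
      ∑ i ∈ Finset.univ.erase (0 : Fin K),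
        boundConst B * (gap μ i * Real.log T / D (μ i + ε) (μ 0 - ε / 2)) := by
    refine Finset.sum_le_sum fun i hi => ?_
    have h1 := hgap i (Finset.ne_of_mem_erase hi)
    have hΔ : 0 < gap μ i := by linarith
    have hg : gap μ i = μ 0 - μ i := rfl
    have e : D (μ i + ε) (μ 0 - ε / 2) = (gap μ i - 3 / 2 * ε) ^ 2 / 2 := by
      rw [D_eq, hg]; ring
    have h2 : 0 < gap μ i - 3 / 2 * ε := by linarith
    have h3 : Real.log T / gap μ i ≤ gap μ i * Real.log T / D (μ i + ε) (μ 0 - ε / 2) := by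
      rw [e, div_le_div_iff₀ hΔ (by positivity)]
      have h4 : (gap μ i - 3 / 2 * ε) ^ 2 ≤ gap μ i ^ 2 :=
        pow_le_pow_left₀ h2.le (by linarith) 2
      nlinarith [mul_le_mul_of_nonneg_left h4 hlogT, mul_nonneg hlogT (sq_nonneg (gap μ i))]
    exact mul_le_mul hC6 h3 (by positivity) (by linarith)
  have hfirst0 : 0 ≤ ∑ i ∈ Finset.univ.erase (0 : Fin K), 6 * (Real.log T / gap μ i) :=
    Finset.sum_nonneg fun i hi => by
      have := hgap i (Finset.ne_of_mem_erase hi)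
      have hΔ : 0 < gap μ i := by linarith
      positivity
  -- The initial cost `K * d` fits into `K^(1/3) T^(2/3)` only if `K ≤ T`; for `T < K` the trivial
  -- bound `T * d` does.
  rcases lt_or_ge T K with hTK | hTK
  · -- short horizons
    have hTK' : (T : ℝ) ≤ K := by exact_mod_cast hTK.le
    have h1 : ∫ ω, regret μ I T ω ∂P ≤ T * d := by
      rw [h.integral_regret_eq]
      have hg : ∀ i, gap μ i ≤ d := fun i => by
        by_cases hi : i = 0
        · rw [hi, gap, sub_self]; exact hd0
        · exact hd i hi
      calc _ ≤ ∑ t ∈ Finset.range T, d :=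
            Finset.sum_le_sum fun t _ => h.integral_gap_arm_le_max hg t
        _ = _ := by simp
    have h2 : (T : ℝ) ≤ Y := by
      calc (T : ℝ) = (T : ℝ) ^ (1 / 3 : ℝ) * (T : ℝ) ^ (2 / 3 : ℝ) :=
            (rpow_third_mul_rpow (by positivity)).symm
        _ ≤ _ := by rw [hY]; gcongr
    have h3 : (T : ℝ) ≤ boundConst B * Λ ^ 3 * Z := by
      have h4 : 8 * B ^ 3 ≤ boundConst B := by
        rw [hC]
        have : 0 ≤ 8 * (46 * B + B ^ 2 + 4) := by positivity
        linarith
      calc (T : ℝ) ≤ 1 * (B ^ 3 * Z) := by linarith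
        _ ≤ 8 * Λ ^ 3 * (B ^ 3 * Z) := by gcongr
        _ = 8 * B ^ 3 * Λ ^ 3 * Z := by ring
        _ ≤ _ := by gcongr
    have h5 := mul_le_mul_of_nonneg_left h3 hd0
    linarith
  · have hTK' : (K : ℝ) ≤ T := by exact_mod_cast hTK
    have hKY : (K : ℝ) ≤ Y := by
      calc (K : ℝ) = (K : ℝ) ^ (1 / 3 : ℝ) * (K : ℝ) ^ (2 / 3 : ℝ) :=
            (rpow_third_mul_rpow (by positivity)).symm
        _ ≤ _ := by rw [hY]; gcongr
    have h1 := h.integral_regret_le hε hgap hd hd0 hT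
    have h2 : (K : ℝ) / ε ^ 2 ≤ B * Z := le_trans (by gcongr) hYZ2
    have h3 : 40 / ε ^ 2 ≤ 40 * (B * Z) := by
      calc 40 / ε ^ 2 = 40 * (1 / ε ^ 2) := by ring
        _ ≤ 40 * (Y / ε ^ 2) := by gcongr
        _ ≤ _ := by gcongr
    have h4 : (1 + Real.log T) ^ 3 ≤ (3 + 2 * Real.log (max B 1)) ^ 3 * Λ ^ 3 := by
      rw [← mul_pow]; exact pow_le_pow_left₀ (by linarith) hlogΛ 3
    have h5 : 48 * (360 * Real.exp 6) * (1 + Real.log T) ^ 3 * Z ≤ c3 * Λ ^ 3 * Z := by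
      rw [hc3]
      refine mul_le_mul_of_nonneg_right ?_ hZ0
      calc _ ≤ 48 * (360 * Real.exp 6) * ((3 + 2 * Real.log (max B 1)) ^ 3 * Λ ^ 3) := by gcongr
        _ = _ := by ring
    -- Supplies the factor `d` missing from the last two terms, at the price of `1 / ε`.
    have hdε : 1 ≤ d / (5 * ε) := by rw [one_le_div (by positivity)]; exact hd5
    have h6 : 2 * (K : ℝ) ≤ d * (B ^ 2 * Z) := by
      calc 2 * (K : ℝ) ≤ 2 * Y := by linarith
        _ ≤ d / (5 * ε) * (2 * Y) := le_mul_of_one_le_left (by positivity) hdε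
        _ = d * (2 / 5 * ε ^ 2 * Z) := by rw [hZ]; field_simp
        _ ≤ d * (1 * B ^ 2 * Z) := by gcongr; norm_num
        _ = _ := by ring
    have h7 : 16 * ((K : ℝ) / ε ^ 2) ≤ d * (4 * Z) := by
      calc 16 * ((K : ℝ) / ε ^ 2) ≤ 16 * (Y / ε ^ 2) := by gcongr
        _ ≤ d / (5 * ε) * (16 * (Y / ε ^ 2)) := le_mul_of_one_le_left (by positivity) hdε
        _ = d * (16 / 5 * Z) := by rw [hZ]; field_simp
        _ ≤ d * (4 * Z) := by gcongr; norm_num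
    have h8 : d * (K + 6 * (K / ε ^ 2) + 40 / ε ^ 2 +
        48 * (360 * Real.exp 6) * (1 + Real.log T) ^ 3 * Z) + (2 * K + 16 * (K / ε ^ 2)) ≤
        d * (boundConst B * Λ ^ 3 * Z) := by
      have h9 : K + 6 * (K / ε ^ 2) + 40 / ε ^ 2 +
          48 * (360 * Real.exp 6) * (1 + Real.log T) ^ 3 * Z + (B ^ 2 * Z + 4 * Z) ≤
          boundConst B * Λ ^ 3 * Z := by
        have h10 : (B ^ 3 + 46 * B + B ^ 2 + 4) * Z ≤
            8 * Λ ^ 3 * ((B ^ 3 + 46 * B + B ^ 2 + 4) * Z) :=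
          le_mul_of_one_le_left (by positivity) hΛ3
        have h11 : 0 ≤ 6 * Λ ^ 3 * Z := by positivity
        rw [hC]
        linarith
      have h12 := mul_le_mul_of_nonneg_left h9 hd0
      linarith
    refine h1.trans ?_
    rw [add_assoc]
    exact add_le_add hfirst h8

/-- The regret bound in terms of the gaps. -/
lemma IsRun.integral_regret_le_gap (h : IsRun P 2 μ X I) (hK : 2 ≤ K)
    (hμ : ∀ i, i ≠ 0 → μ i < μ 0) {B : ℝ} (hB : 0 < B) {T : ℕ} (hT : 1 ≤ T)
    (hgB : gapMin μ ≤ B) :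
    ∫ ω, regret μ I T ω ∂P ≤
      ∑ i ∈ Finset.univ.erase (0 : Fin K), 3375 * boundConst B * (Real.log T / gap μ i)
        + gapMax μ * (3375 * boundConst B * Real.log (2 + K * T / gapMin μ) ^ 3 *
          ((K : ℝ) ^ (1 / 3 : ℝ) * (T : ℝ) ^ (2 / 3 : ℝ) / gapMin μ ^ 3)) := by
  have hg := gapMin_pos hK hμ
  have hT1 : (1 : ℝ) ≤ T := by exact_mod_cast hT
  have hlogT : 0 ≤ Real.log T := Real.log_nonneg hT1
  have hC0 : 0 ≤ boundConst B := (boundConst_pos hB).le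
  have hd0 : 0 ≤ gapMax μ := hg.le.trans (gapMin_le_gapMax hK μ)
  -- The largest admissible `ε`. The constant is `3375 = 27 * 125`: `27` from the cubed logarithm,
  -- since `2 + 5 x ≤ (2 + x) ^ 3`, and `125` from `ε ^ 3`.
  refine (h.integral_regret_le_divergence hK hB hT (ε := gapMin μ / 5) (by positivity) le_rfl
    (by linarith)).trans (add_le_add (Finset.sum_le_sum fun i hi => ?_)
    (mul_le_mul_of_nonneg_left ?_ hd0))
  · have hi := Finset.ne_of_mem_erase hi
    have h1 := gapMin_le_gap μ hi
    have hΔ : 0 < gap μ i := by linarith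
    have e : D (μ i + gapMin μ / 5) (μ 0 - gapMin μ / 5 / 2) =
        (gap μ i - 3 / 10 * gapMin μ) ^ 2 / 2 := by
      rw [D_eq, gap]; ring
    have h2 : gap μ i * Real.log T / D (μ i + gapMin μ / 5) (μ 0 - gapMin μ / 5 / 2) ≤
        5 * (Real.log T / gap μ i) := by
      have h3 : (7 / 10 * gap μ i) ^ 2 / 2 ≤ (gap μ i - 3 / 10 * gapMin μ) ^ 2 / 2 := by
        gcongr
        linarith
      rw [e]
      calc _ ≤ gap μ i * Real.log T / ((7 / 10 * gap μ i) ^ 2 / 2) := by gcongr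
        _ = 200 / 49 * (Real.log T / gap μ i) := by field_simp; ring
        _ ≤ _ := by gcongr; norm_num
    calc _ ≤ boundConst B * (5 * (Real.log T / gap μ i)) := by gcongr
      _ = 5 * boundConst B * (Real.log T / gap μ i) := by ring
      _ ≤ _ := by gcongr; norm_num
  · set x : ℝ := K * T / gapMin μ with hx
    have hx0 : 0 ≤ x := by positivity
    have e1 : K * T / (gapMin μ / 5) = 5 * x := by rw [hx]; field_simp
    have h1 : Real.log (2 + 5 * x) ≤ 3 * Real.log (2 + x) := by
      have : 3 * Real.log (2 + x) = Real.log ((2 + x) ^ 3) := by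
        rw [Real.log_pow]; norm_num
      rw [this]
      refine Real.log_le_log (by positivity) ?_
      nlinarith [pow_nonneg hx0 3, pow_nonneg hx0 2]
    have h2 : 0 ≤ Real.log (2 + 5 * x) := Real.log_nonneg (by linarith)
    have h3 : Real.log (2 + 5 * x) ^ 3 ≤ 27 * Real.log (2 + x) ^ 3 := by
      calc _ ≤ (3 * Real.log (2 + x)) ^ 3 := pow_le_pow_left₀ h2 h1 3
        _ = _ := by ring
    rw [e1]
    set Y := (K : ℝ) ^ (1 / 3 : ℝ) * (T : ℝ) ^ (2 / 3 : ℝ) with hY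
    have e2 : Y / (gapMin μ / 5) ^ 3 = 125 * (Y / gapMin μ ^ 3) := by field_simp; norm_num
    rw [e2]
    calc _ ≤ boundConst B * (27 * Real.log (2 + x) ^ 3) * (125 * (Y / gapMin μ ^ 3)) := by gcongr
      _ = _ := by ring

lemma isLittleO_log_pow_mul_rpow {a : ℝ} (ha : 0 < a) :
    (fun T : ℕ => Real.log (2 + a * T) ^ 3 * (T : ℝ) ^ (2 / 3 : ℝ)) =o[Filter.atTop]
      fun T : ℕ => (T : ℝ) := by
  have h1 : (fun x : ℝ => Real.log x ^ 3) =o[Filter.atTop] fun x => x ^ (1 / 3 : ℝ) := by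
    have := isLittleO_log_rpow_rpow_atTop 3 (show (0 : ℝ) < 1 / 3 by norm_num)
    refine this.congr' (Filter.Eventually.of_forall fun x => ?_) Filter.EventuallyEq.rfl
    exact_mod_cast Real.rpow_natCast (Real.log x) 3
  have ht : Filter.Tendsto (fun T : ℕ => 2 + a * (T : ℝ)) Filter.atTop Filter.atTop :=
    Filter.tendsto_atTop_add_const_left _ _
      (Filter.Tendsto.const_mul_atTop ha tendsto_natCast_atTop_atTop)
  have h2 := h1.comp_tendsto ht
  have h3 : (fun T : ℕ => (2 + a * (T : ℝ)) ^ (1 / 3 : ℝ)) =O[Filter.atTop]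
      fun T : ℕ => (T : ℝ) ^ (1 / 3 : ℝ) := by
    refine Asymptotics.IsBigO.of_bound ((2 + a) ^ (1 / 3 : ℝ)) ?_
    filter_upwards [Filter.eventually_ge_atTop 1] with T hT
    have hT1 : (1 : ℝ) ≤ T := by exact_mod_cast hT
    rw [Real.norm_of_nonneg (by positivity), Real.norm_of_nonneg (by positivity),
      ← Real.mul_rpow (by positivity) (by positivity)]
    refine Real.rpow_le_rpow (by positivity) ?_ (by norm_num)
    nlinarith
  have h4 := (h2.trans_isBigO h3).mul_isBigO
    (Asymptotics.isBigO_refl (fun T : ℕ => (T : ℝ) ^ (2 / 3 : ℝ)) Filter.atTop)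
  refine h4.congr (fun T => rfl) fun T => ?_
  exact rpow_third_mul_rpow (by positivity)

/-- The expected regret is sublinear. -/
lemma IsRun.isLittleO_integral_regret (h : IsRun P 2 μ X I) (hK : 2 ≤ K)
    (hμ : ∀ i, i ≠ 0 → μ i < μ 0) :
    (fun T : ℕ => ∫ ω, regret μ I T ω ∂P) =o[Filter.atTop] fun T : ℕ => (T : ℝ) := by
  have hg := gapMin_pos hK hμ
  have hK0 : (0 : ℝ) < K := by exact_mod_cast (by omega : 0 < K)
  -- For a fixed instance `B` may be `gapMin μ` itself.
  set c := 3375 * boundConst (gapMin μ) with hc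
  set a : ℝ := K / gapMin μ with ha
  have hlog : (fun T : ℕ => Real.log (T : ℝ)) =o[Filter.atTop] fun T : ℕ => (T : ℝ) :=
    Real.isLittleO_log_id_atTop.comp_tendsto tendsto_natCast_atTop_atTop
  have h1 : (fun T : ℕ => ∑ i ∈ Finset.univ.erase (0 : Fin K), c * (Real.log T / gap μ i)) =o[
      Filter.atTop] fun T : ℕ => (T : ℝ) := by
    have hi : ∀ i ∈ Finset.univ.erase (0 : Fin K),
        (fun T : ℕ => c * (Real.log T / gap μ i)) =o[Filter.atTop] fun T : ℕ => (T : ℝ) :=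
      fun i _ => (hlog.const_mul_left (c / gap μ i)).congr_left fun T => by ring
    exact Asymptotics.IsLittleO.fun_sum hi
  have h2 : (fun T : ℕ => gapMax μ * (c * Real.log (2 + K * T / gapMin μ) ^ 3 *
      ((K : ℝ) ^ (1 / 3 : ℝ) * (T : ℝ) ^ (2 / 3 : ℝ) / gapMin μ ^ 3))) =o[Filter.atTop]
      fun T : ℕ => (T : ℝ) := by
    have ha0 : 0 < a := by positivity
    refine ((isLittleO_log_pow_mul_rpow ha0).const_mul_left
      (gapMax μ * c * (K : ℝ) ^ (1 / 3 : ℝ) / gapMin μ ^ 3)).congr_left fun T => ?_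
    have : a * (T : ℝ) = K * T / gapMin μ := by rw [ha]; ring
    rw [this]
    ring
  have h4 := h1.add h2
  refine Asymptotics.IsLittleO.of_bound fun q hq => ?_
  have h5 := h4.bound hq
  filter_upwards [Filter.eventually_ge_atTop 1, h5] with T hT hq5
  have h3 : 0 ≤ ∫ ω, regret μ I T ω ∂P := integral_nonneg fun ω => by
    refine Finset.sum_nonneg fun t _ => ?_
    by_cases hi : I t ω = 0
    · rw [hi, sub_self]
    · exact (sub_pos.2 (hμ _ hi)).le
  rw [Real.norm_of_nonneg h3]
  exact (h.integral_regret_le_gap hK hμ hg hT le_rfl).trans ((le_abs_self _).trans hq5)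

end Run

end ReMax

theorem theorem1 :
    -- the two non-asymptotic bounds
    (∃ p : ℕ, ∀ B : ℝ, 0 < B → ∃ C : ℝ, 0 < C ∧
      ∀ (K : ℕ) [NeZero K] (μ : Fin K → ℝ), 2 ≤ K → (∀ i, i ≠ 0 → μ i < μ 0) →
      ∀ (Ω : Type*) [MeasurableSpace Ω] (P : Measure Ω) [IsProbabilityMeasure P]
        (X : Fin K → ℕ → Ω → ℝ) (I : ℕ → Ω → Fin K), ReMax.IsRun P 2 μ X I →
      ∀ T : ℕ, 1 ≤ T →
        (∀ ε : ℝ, 0 < ε → ε ≤ ReMax.gapMin μ / 5 → ε ≤ B →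
          ∫ ω, ReMax.regret μ I T ω ∂P ≤
            ∑ i ∈ Finset.univ.erase (0 : Fin K),
                C * (ReMax.gap μ i * Real.log T / ReMax.D (μ i + ε) (μ 0 - ε / 2))
              + ReMax.gapMax μ *
                (C * Real.log (2 + K * T / ε) ^ p *
                  ((K : ℝ) ^ (1 / 3 : ℝ) * (T : ℝ) ^ (2 / 3 : ℝ) / ε ^ 3))) ∧
        (ReMax.gapMin μ ≤ B →
          ∫ ω, ReMax.regret μ I T ω ∂P ≤
            ∑ i ∈ Finset.univ.erase (0 : Fin K), C * (Real.log T / ReMax.gap μ i)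
              + ReMax.gapMax μ *
                (C * Real.log (2 + K * T / ReMax.gapMin μ) ^ p *
                  ((K : ℝ) ^ (1 / 3 : ℝ) * (T : ℝ) ^ (2 / 3 : ℝ) / ReMax.gapMin μ ^ 3)))) ∧
    -- the expected regret of every instance is sublinear
    (∀ (K : ℕ) [NeZero K] (μ : Fin K → ℝ), 2 ≤ K → (∀ i, i ≠ 0 → μ i < μ 0) →
      ∀ (Ω : Type*) [MeasurableSpace Ω] (P : Measure Ω) [IsProbabilityMeasure P]
        (X : Fin K → ℕ → Ω → ℝ) (I : ℕ → Ω → Fin K), ReMax.IsRun P 2 μ X I →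
      (fun T : ℕ => ∫ ω, ReMax.regret μ I T ω ∂P) =o[Filter.atTop] fun T : ℕ => (T : ℝ)) := by

  -- The three logarithms come from the cube root of `logFactor`, rounded up to a full power, from
  -- the factor `l + 1` in `1 / levelValue k l`, and from the number of levels.
  refine ⟨⟨3, fun B hB => ⟨3375 * ReMax.boundConst B, ?_, ?_⟩⟩, ?_⟩
  · exact mul_pos (by norm_num) (ReMax.boundConst_pos hB)
  · intro K _ μ hK hμ Ω _ P _ X I h T hT
    refine ⟨fun ε hε hεg hεB => ?_, fun hgB => h.integral_regret_le_gap hK hμ hB hT hgB⟩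
    have hC := (ReMax.boundConst_pos hB).le
    have hCle : ReMax.boundConst B ≤ 3375 * ReMax.boundConst B := by linarith
    have hT1 : (1 : ℝ) ≤ T := by exact_mod_cast hT
    have hlogT : 0 ≤ Real.log T := Real.log_nonneg hT1
    have hd : 0 ≤ ReMax.gapMax μ :=
      (ReMax.gapMin_pos hK hμ).le.trans (ReMax.gapMin_le_gapMax hK μ)
    have hlog : 0 ≤ Real.log (2 + K * T / ε) := by
      have : (0 : ℝ) ≤ K * T / ε := by positivity
      exact Real.log_nonneg (by linarith)
    refine (h.integral_regret_le_divergence hK hB hT hε hεg hεB).trans ?_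
    refine add_le_add (Finset.sum_le_sum fun i hi => mul_le_mul_of_nonneg_right hCle ?_) ?_
    · have hΔ : 0 ≤ ReMax.gap μ i := (sub_pos.2 (hμ i (Finset.ne_of_mem_erase hi))).le
      rw [ReMax.D_eq]
      positivity
    · gcongr
  · intro K _ μ hK hμ Ω _ P _ X I h
    exact h.isLittleO_integral_regret hK hμ
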